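/- A 3-SAT instance is a Boolean formula $\Phi$ that is a conjunction of clauses, each a disjunction of at most three literals; its solutions are the satisfying assignments to the variables occurring in $\Phi$. A polarised switching circuit $(G,T)$ is a finite directed graph (loops and multiple edges allowed) in which every vertex $v$ has equal in- and out-valency $\partial(v)$, with the edges into $v$ and the edges out of $v$ each labelled by $1,\dots,\partial(v)$, together with an equivalence relation $T$ on the vertices whose equivalent vertices have equal valency. A routing $\rho$ chooses a permutation $\rho(v)\in S_{\partial(v)}$ for every vertex $v$; it decomposes the edge set into directed cycles (an edge entering $v$ with label $i$ is followed by the edge leaving $v$ with label $\rho(v)(i)$), and it respects $T$ if $\rho(u)=\rho(v)$ whenever $u$ and $v$ are equivalent. An instance of Width6–Valency2–Maximal–Routing is a polarised switching circuit all of whose classes have at most $6$ vertices and all of whose vertices have valency at most $2$, together with a positive integer $K$; its solutions are the routings that respect $T$ and have at least $K$ cycles. Theorem 6. There is a polynomial-time parsimonious transformation from 3-SAT to Width6–Valency2–Maximal–Routing, that is, a map $\Phi\mapsto((G,T),K)$, computable by a Turing machine in time polynomial in the length of the input (variable indices and all numbers being written in binary), such that the number of satisfying assignments of $\Phi$ equals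 the number of routings of $G$ that respect $T$ and have at least $K$ cycles. Moreover, the transformation can be chosen so that the following holds for every formula $\Phi$ with at least one clause and no empty clause. Let $b$, $g$, $i$ be the numbers of clauses of $\Phi$ with exactly three, two and one literals, let $e=\sum_x (r_x-1)$, where $x$ runs over the variables of $\Phi$ and $r_x$ is the number of occurrences of $x$ in $\Phi$, and put $M=3b+4g+2i+2e$. Then $K=M$, no routing respecting $T$ has more than $M$ cycles, and there is an injective map $\alpha\mapsto\rho_\alpha$ from the assignments of $\Phi$ to the routings respecting $T$ such that the routings respecting $T$ with exactly $M$ cycles are precisely the $\rho_\alpha$ with $\alpha$ satisfying $\Phi$. -/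

import Mathlib

open Computability

/-! ### Problems with finitely many solutions and parsimonious transformations -/

/-- A problem: instances written as strings over a fixed finite alphabet, and for every instance
a finite type of solutions. The answer to an instance is "yes" when it has a solution. -/
structure CountingProblem where
  /-- the instances -/
  Instance : Type
  /-- the string that represents an instance -/
  encode : Instance → List Γ'
  /-- different instances have different strings -/
  encode_injective : Function.Injective encode
  /-- the solutions of an instance -/
  Solution : Instance → Type
  /-- there are finitely many solutions -/
  finite_solution : ∀ x, Finite (Solution x)

/-- `f` is a polynomial-time parsimonious transformation from `P` to `Q`: some multi-stack Turing
machine computes it in polynomially many steps in the length of the input string, and it preserves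
the number of solutions. -/
def IsParsimoniousTransformation (P Q : CountingProblem) (f : P.Instance → Q.Instance) : Prop :=
  Nonempty (Turing.TM2ComputableInPolyTime P.encode Q.encode f) ∧
    ∀ x, Nat.card (P.Solution x) = Nat.card (Q.Solution (f x))

/-! ### Strings for natural numbers -/

/-- Binary digits of `n`, least significant first, followed by a comma. -/
def encodeBinary (n : ℕ) : List Γ' := n.bits.map Γ'.bit ++ [Γ'.comma]

/-- A list of naturals, each written in binary and followed by a comma. -/
def encodeNats (l : List ℕ) : List Γ' := (l.map encodeBinary).flatten

theorem map_bit_append_cancel {a b : List Bool} {s t : List Γ'}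
    (h : a.map Γ'.bit ++ Γ'.comma :: s = b.map Γ'.bit ++ Γ'.comma :: t) : a = b ∧ s = t := by
  induction a generalizing b with
  | nil => cases b <;> simp_all
  | cons x a ih =>
    cases b with
    | nil => simp at h
    | cons y b =>
      simp only [List.map_cons, List.cons_append, List.cons.injEq, Γ'.bit.injEq] at h
      obtain ⟨rfl, h⟩ := h
      obtain ⟨rfl, rfl⟩ := ih h
      exact ⟨rfl, rfl⟩

theorem bits_injective : Function.Injective Nat.bits := by
  intro m n h
  have h2 := congrArg (fun l : List Bool => Nat.ofDigits 2 (l.map fun b => cond b 1 0)) h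
  simpa only [← Nat.digits_two_eq_bits, Nat.ofDigits_digits] using h2

theorem encodeNats_injective : Function.Injective encodeNats := by
  intro l
  induction l with
  | nil => intro m h; cases m <;> simp_all [encodeNats, encodeBinary]
  | cons x l ih =>
    intro m h
    cases m with
    | nil => simp [encodeNats, encodeBinary] at h
    | cons y m =>
      simp only [encodeNats, encodeBinary, List.map_cons, List.flatten_cons, List.append_assoc,
        List.singleton_append] at h
      obtain ⟨h1, h2⟩ := map_bit_append_cancel h
      rw [bits_injective h1, ih h2]

/-! ### 3-SAT -/

/-- A literal: the variable `x_i` with `i = var`, negated if `positive` is `false`. -/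
structure Literal where
  /-- index of the variable -/
  var : ℕ
  /-- `true` for `x_i`, `false` for its negation -/
  positive : Bool

/-- A Boolean formula that is a conjunction of clauses, each a disjunction of at most three
literals. Repetitions of clauses, and of variables in a clause, are allowed. -/
structure ThreeCNF where
  /-- the clauses -/
  clauses : List (List Literal)
  /-- each clause has at most three literals -/
  length_le : ∀ C ∈ clauses, C.length ≤ 3

namespace ThreeCNF

/-- The variables of the formula, one entry for each occurrence. -/
def occurrences (Φ : ThreeCNF) : List ℕ := Φ.clauses.flatten.map Literal.var

/-- The set of variables that occur in the formula. -/
def vars (Φ : ThreeCNF) : Finset ℕ := Φ.occurrences.toFinset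

/-- A truth assignment to the variables of the formula. -/
abbrev Assignment (Φ : ThreeCNF) : Type := {x : ℕ // x ∈ Φ.vars} → Bool

/-- The assignment gives the formula the value true: each clause contains a true literal. -/
def Satisfies (Φ : ThreeCNF) (α : Φ.Assignment) : Prop :=
  ∀ C ∈ Φ.clauses, ∃ l ∈ C, ∃ h : l.var ∈ Φ.vars, α ⟨l.var, h⟩ = l.positive

/-- The string for a literal: its sign, the binary digits of the index, and a comma. -/
def encodeLiteral (l : Literal) : List Γ' := Γ'.bit l.positive :: encodeBinary l.var

/-- The string for a clause: its literals, enclosed in brackets. -/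
def encodeClause (C : List Literal) : List Γ' :=
  Γ'.bra :: ((C.map encodeLiteral).flatten ++ [Γ'.ket])

/-- The string for a formula. -/
def encode (Φ : ThreeCNF) : List Γ' := (Φ.clauses.map encodeClause).flatten

theorem literals_append_cancel {C D : List Literal} {s t : List Γ'}
    (h : (C.map encodeLiteral).flatten ++ Γ'.ket :: s =
      (D.map encodeLiteral).flatten ++ Γ'.ket :: t) : C = D ∧ s = t := by
  induction C generalizing D with
  | nil => cases D <;> simp_all [encodeLiteral]
  | cons x C ih =>
    cases D with
    | nil => simp [encodeLiteral] at h
    | cons y D =>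
      obtain ⟨i, p⟩ := x
      obtain ⟨j, q⟩ := y
      simp only [encodeLiteral, encodeBinary, List.map_cons, List.flatten_cons, List.cons_append,
        List.append_assoc, List.nil_append, List.cons.injEq, Γ'.bit.injEq] at h
      obtain ⟨rfl, h⟩ := h
      obtain ⟨h1, h2⟩ := map_bit_append_cancel h
      obtain ⟨rfl, rfl⟩ := ih h2
      rw [bits_injective h1]
      exact ⟨rfl, rfl⟩

theorem encode_injective : Function.Injective encode := by
  have key : ∀ l m : List (List Literal),
      (l.map encodeClause).flatten = (m.map encodeClause).flatten → l = m := by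
    intro l
    induction l with
    | nil => intro m h; cases m <;> simp_all [encodeClause]
    | cons C l ih =>
      intro m h
      cases m with
      | nil => simp [encodeClause] at h
      | cons D m =>
        simp only [encodeClause, List.map_cons, List.flatten_cons, List.cons_append,
          List.append_assoc, List.nil_append, List.cons.injEq, true_and] at h
        obtain ⟨rfl, h2⟩ := literals_append_cancel h
        rw [ih m h2]
  rintro ⟨l, hl⟩ ⟨m, hm⟩ h
  obtain rfl := key l m h
  rfl

/-- The number of clauses with exactly `j` literals. -/
def numClauses (Φ : ThreeCNF) (j : ℕ) : ℕ := Φ.clauses.countP fun C => C.length = j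

/-- The number of equivalences needed to identify all occurrences of each variable: `r - 1` for a
variable with `r` occurrences. -/
def numEquivalences (Φ : ThreeCNF) : ℕ := ∑ x ∈ Φ.vars, (Φ.occurrences.count x - 1)

/-- The threshold `M = 3b + 4g + 2i + 2e`. -/
def cycleThreshold (Φ : ThreeCNF) : ℕ :=
  3 * Φ.numClauses 3 + 4 * Φ.numClauses 2 + 2 * Φ.numClauses 1 + 2 * Φ.numEquivalences

end ThreeCNF

/-- The problem 3-SAT; the solutions are the satisfying assignments. -/
def threeSAT : CountingProblem where
  Instance := ThreeCNF
  encode := ThreeCNF.encode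
  encode_injective := ThreeCNF.encode_injective
  Solution Φ := {α : Φ.Assignment // Φ.Satisfies α}
  finite_solution _ := inferInstance

/-! ### Switching circuits -/

/-- A polarised switching circuit with vertex set `V` and edge set `E`; loops and multiple edges
are allowed. -/
@[ext]
structure PolarisedCircuit (V E : Type) where
  /-- the vertex that an edge leaves -/
  src : E → V
  /-- the vertex that an edge enters -/
  tgt : E → V
  /-- the common value of the in-valency and the out-valency -/
  valency : V → ℕ
  /-- labels of the edges out of a vertex -/
  outLabel : ∀ v, {e : E // src e = v} ≃ Fin (valency v)
  /-- labels of the edges into a vertex -/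
  inLabel : ∀ v, {e : E // tgt e = v} ≃ Fin (valency v)
  /-- the polarisation -/
  pol : Setoid V
  /-- equivalent vertices have the same valency -/
  valency_eq : ∀ {u v : V}, pol u v → valency u = valency v

namespace PolarisedCircuit

variable {V E : Type}

/-- A routing: a permutation of the labels at each vertex. -/
abbrev Routing (G : PolarisedCircuit V E) : Type := ∀ v, Equiv.Perm (Fin (G.valency v))

/-- A routing respects the polarisation if equivalent vertices carry the same permutation. -/
def Respects (G : PolarisedCircuit V E) (ρ : G.Routing) : Prop :=
  ∀ (u v : V) (h : G.pol u v), ρ v = (finCongr (G.valency_eq h)).permCongr (ρ u)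

/-- The successor of each edge under a routing: an edge that enters `v` with label `i` is followed
by the edge that leaves `v` with label `ρ v i`. -/
def next (G : PolarisedCircuit V E) (ρ : G.Routing) : Equiv.Perm E :=
  (Equiv.sigmaFiberEquiv G.tgt).symm.trans <|
    (Equiv.sigmaCongrRight fun v => (G.inLabel v).trans ((ρ v).trans (G.outLabel v).symm)).trans <|
      Equiv.sigmaFiberEquiv G.src

/-- The number of directed cycles into which a routing decomposes the edge set. -/
noncomputable def numCycles (G : PolarisedCircuit V E) (ρ : G.Routing) : ℕ :=
  Nat.card (Quotient (Equiv.Perm.SameCycle.setoid (G.next ρ)))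

/-- Each class of the polarisation has at most `w` vertices. -/
def WidthLE (G : PolarisedCircuit V E) (w : ℕ) : Prop := ∀ u, Nat.card {v // G.pol u v} ≤ w

/-- Each vertex has in- and out-valency at most `d`. -/
def ValencyLE (G : PolarisedCircuit V E) (d : ℕ) : Prop := ∀ v, G.valency v ≤ d

end PolarisedCircuit

/-- An instance of maximal routing: a finite polarised switching circuit and a positive integer. -/
structure RoutingInstance where
  /-- number of vertices -/
  numV : ℕ
  /-- number of edges -/
  numE : ℕ
  /-- the circuit -/
  circuit : PolarisedCircuit (Fin numV) (Fin numE)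
  /-- the number of cycles asked for -/
  target : ℕ
  /-- it is positive -/
  target_pos : 0 < target

namespace RoutingInstance

/-- A routing that respects the polarisation. -/
abbrev RespectingRouting (I : RoutingInstance) : Type :=
  {ρ : I.circuit.Routing // I.circuit.Respects ρ}

/-- The least vertex in the class of `v`. -/
noncomputable def classRep (I : RoutingInstance) (v : Fin I.numV) : ℕ :=
  sInf {n | ∃ u : Fin I.numV, I.circuit.pol u v ∧ u.val = n}

/-- An edge as four numbers: where it leaves, with which label, where it enters, with which
label. -/
def edgeData (I : RoutingInstance) (e : Fin I.numE) : List ℕ :=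
  [(I.circuit.src e).val, (I.circuit.outLabel _ ⟨e, rfl⟩).val,
    (I.circuit.tgt e).val, (I.circuit.inLabel _ ⟨e, rfl⟩).val]

/-- The string for an instance: the number of vertices, the least equivalent vertex of each vertex,
the data of each edge, and the number of cycles asked for, all in binary. -/
noncomputable def encode (I : RoutingInstance) : List Γ' :=
  encodeNats (I.numV :: (List.ofFn I.classRep ++ ((List.ofFn I.edgeData).flatten ++ [I.target])))

theorem pol_iff_classRep (I : RoutingInstance) (u v : Fin I.numV) :
    I.circuit.pol u v ↔ I.classRep u = I.classRep v := by
  constructor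
  · intro h
    unfold classRep
    congr 1
    ext n
    exact ⟨fun ⟨x, hx, hn⟩ => ⟨x, I.circuit.pol.trans hx h, hn⟩,
      fun ⟨x, hx, hn⟩ => ⟨x, I.circuit.pol.trans hx (I.circuit.pol.symm h), hn⟩⟩
  · intro h
    have key : ∀ w : Fin I.numV, ∃ x : Fin I.numV, I.circuit.pol x w ∧ x.val = I.classRep w :=
      fun w => Nat.sInf_mem (s := {n | ∃ x : Fin I.numV, I.circuit.pol x w ∧ x.val = n})
        ⟨w.val, w, I.circuit.pol.refl w, rfl⟩
    obtain ⟨x, hx, hxn⟩ := key u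
    obtain ⟨y, hy, hyn⟩ := key v
    have hxy : x = y := Fin.ext (by rw [hxn, hyn, h])
    subst hxy
    exact I.circuit.pol.trans (I.circuit.pol.symm hx) hy

theorem length_flatten_edgeData (I : RoutingInstance) :
    ((List.ofFn I.edgeData).flatten).length = 4 * I.numE := by
  rw [List.length_flatten, List.map_ofFn]
  have : (List.length ∘ I.edgeData) = fun _ => 4 := rfl
  rw [this, List.ofFn_const, List.sum_replicate, smul_eq_mul, mul_comm]

theorem encode_injective : Function.Injective encode := by
  intro I J h
  have h := encodeNats_injective h
  simp only [List.cons.injEq] at h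
  obtain ⟨hV, h⟩ := h
  obtain ⟨h1, h⟩ := List.append_inj h (by simp [hV])
  obtain ⟨h2, h3⟩ := List.append_inj' h rfl
  have hE : I.numE = J.numE := by
    have := congrArg List.length h2
    rw [length_flatten_edgeData, length_flatten_edgeData] at this
    omega
  have hpI := I.pol_iff_classRep
  have hpJ := J.pol_iff_classRep
  obtain ⟨n, m, G, K, hK⟩ := I
  obtain ⟨n', m', G', K', hK'⟩ := J
  dsimp only at hV hE h3
  subst hV hE
  obtain rfl : K = K' := by simpa using h3
  have h1 := List.ofFn_injective h1
  have h2' : List.ofFn (edgeData ⟨n, m, G, K, hK⟩) = List.ofFn (edgeData ⟨n, m, G', K, hK'⟩) := by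
    refine List.eq_iff_flatten_eq.2 ⟨h2, ?_⟩
    rw [List.map_ofFn, List.map_ofFn]
    rfl
  have h2 := List.ofFn_injective h2'
  have hpol : G.pol = G'.pol := by
    ext u v
    exact (hpI u v).trans ((by rw [h1] : _ ↔ _).trans (hpJ u v).symm)
  clear hpI hpJ h1 h2' h
  have hsrc : G.src = G'.src := by
    funext e
    have := congrFun h2 e
    simp only [edgeData, List.cons.injEq] at this
    exact Fin.ext this.1
  have htgt : G.tgt = G'.tgt := by
    funext e
    have := congrFun h2 e
    simp only [edgeData, List.cons.injEq] at this
    exact Fin.ext this.2.2.1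
  have hout : ∀ e, (G.outLabel _ ⟨e, rfl⟩).val = (G'.outLabel _ ⟨e, rfl⟩).val := by
    intro e
    have := congrFun h2 e
    simp only [edgeData, List.cons.injEq] at this
    exact this.2.1
  have hin : ∀ e, (G.inLabel _ ⟨e, rfl⟩).val = (G'.inLabel _ ⟨e, rfl⟩).val := by
    intro e
    have := congrFun h2 e
    simp only [edgeData, List.cons.injEq] at this
    exact this.2.2.2.1
  clear h2
  obtain ⟨s, t, d, o, i, p, hp⟩ := G
  obtain ⟨s', t', d', o', i', p', hp'⟩ := G'
  dsimp only at hpol hsrc htgt hout hin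
  subst hpol hsrc htgt
  obtain rfl : d = d' := by
    funext v
    have := Fintype.card_congr ((o v).symm.trans (o' v))
    simpa using this
  obtain rfl : o = o' := by
    funext v
    ext ⟨e, he⟩
    subst he
    exact hout e
  obtain rfl : i = i' := by
    funext v
    ext ⟨e, he⟩
    subst he
    exact hin e
  rfl

end RoutingInstance

/-- The problem of maximal routing with width at most `w` and valency at most `d`; the solutions
are the routings that respect the polarisation and have at least the required number of cycles. -/
noncomputable def maximalRouting (w d : ℕ) : CountingProblem where
  Instance := {I : RoutingInstance // I.circuit.WidthLE w ∧ I.circuit.ValencyLE d}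
  encode I := I.1.encode
  encode_injective := RoutingInstance.encode_injective.comp Subtype.val_injective
  Solution I := {ρ : I.1.RespectingRouting // I.1.target ≤ I.1.circuit.numCycles ρ.1}
  finite_solution _ := inferInstance

/-!
# A parsimonious reduction from 3-SAT to maximal routing

All vertices of the circuits below have valency two, so that a routing swaps the labels at some
vertices and not at the others; if it respects the polarisation it is a function `b` from the
classes, which are named by numbers called keys, to `Fin 2`. A circuit is thus a permutation `wire`
of the ports `(vertex, label)` together with a key for each vertex (`Gadget`), and the cycles of the
routing are those of `wire` followed by the swaps given by `b` (`Gadget.numCycles_routing`). The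
number of cycles is additive over disjoint unions (`Gadget.cycles_join`).

Each occurrence of a variable in the formula has its own key. A clause with `1`, `2` or `3` literals
is represented by a circuit on `1`, `4` or `6` vertices that has `2`, `4` or `3` cycles if one of
the literals is true, and fewer otherwise (`Gadget.cycles_clauseGadget`, a finite computation); a
negated literal is handled by swapping the labels of the incoming edges once and for all. Two keys
are forced to have the same value by a circuit with two vertices, which has two cycles if the values
agree and one otherwise (`Gadget.cycles_eqGadget`). One such circuit for each pair of consecutive
occurrences of the same variable turns `b` into an assignment. Hence no routing has more cycles than
`Gadget.formulaTarget`, and the routings with that many cycles correspond to the satisfying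
assignments (`Gadget.cycles_formulaGadget_le`, `ThreeCNF.numCycles_eq_iff`). Every occurrence
belongs to at most two pairs, so a class has at most two vertices in the circuits of the clauses
and at most two in the other ones. An empty clause contributes no vertices, but raises the target to
a number of cycles that is not attained; only the formula without clauses has to be treated
separately, since the target must be positive.

For the time bound, the transformation is written in a small language of structured programs on a
fixed set of stacks (`Prog`), which are compiled to multi-stack Turing machines
(`Prog.computableInPolyTime_of_run`). The relation `Prog.Run p m m' t` states that `p` leads from
the stack contents `m` to `m'` in at most `t` steps. The program reads the clauses and writes their
circuits and the list of the entries `(variable, key)` of all occurrences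
(`Prog.run_readClauses`). Then it takes the first entry off the list and scans the remaining ones:
those of the same variable are identified with each other along a chain, and the other ones are put
back for the next round (`Prog.run_rounds`); this is the recursion in `equivPairs`. Numbers that
have to be added to, like keys and the number of vertices, are kept in unary until they are written,
which is possible because they are linear in the length of the input.
-/

/-! ### Counting the cycles of a permutation -/

/-- The number of cycles of a permutation, fixed points included. -/
noncomputable def cycleCount {α : Type} (σ : Equiv.Perm α) : ℕ :=
  Nat.card (Quotient (Equiv.Perm.SameCycle.setoid σ))

theorem sameCycle_permCongr {α β : Type} (e : α ≃ β) (σ : Equiv.Perm α) (x y : α) :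
    (e.permCongr σ).SameCycle (e x) (e y) ↔ σ.SameCycle x y := by
  have h : ∀ i : ℤ, (e.permCongr σ) ^ i = e.permCongr (σ ^ i) := fun i =>
    (map_zpow e.permCongrHom σ i).symm
  simp [Equiv.Perm.SameCycle, h]

theorem cycleCount_permCongr {α β : Type} (e : α ≃ β) (σ : Equiv.Perm α) :
    cycleCount (e.permCongr σ) = cycleCount σ :=
  (Nat.card_congr (Quotient.congr e fun x y => (sameCycle_permCongr e σ x y).symm)).symm

theorem sumCongr_zpow {α β : Type} (σ : Equiv.Perm α) (τ : Equiv.Perm β) (i : ℤ) :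
    (Equiv.sumCongr σ τ : Equiv.Perm (α ⊕ β)) ^ i = Equiv.sumCongr (σ ^ i) (τ ^ i) :=
  (map_zpow (Equiv.Perm.sumCongrHom α β) (σ, τ) i).symm

/-- A block sum of two permutations has the cycles of both. -/
theorem cycleCount_sumCongr {α β : Type} [Finite α] [Finite β] (σ : Equiv.Perm α)
    (τ : Equiv.Perm β) :
    cycleCount (Equiv.sumCongr σ τ : Equiv.Perm (α ⊕ β)) = cycleCount σ + cycleCount τ := by
  unfold cycleCount
  rw [← Nat.card_sum]
  refine Nat.card_congr
    { toFun := Quotient.lift (Sum.elim (fun x => Sum.inl (Quotient.mk _ x))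
        fun y => Sum.inr (Quotient.mk _ y)) ?_
      invFun := Sum.elim (Quotient.map Sum.inl ?_) (Quotient.map Sum.inr ?_)
      left_inv := ?_
      right_inv := ?_ }
  · rintro (x | x) (y | y) ⟨i, h⟩
    · rw [sumCongr_zpow] at h
      exact congrArg Sum.inl (Quotient.sound ⟨i, Sum.inl.inj h⟩)
    · rw [sumCongr_zpow] at h
      simp at h
    · rw [sumCongr_zpow] at h
      simp at h
    · rw [sumCongr_zpow] at h
      exact congrArg Sum.inr (Quotient.sound ⟨i, Sum.inr.inj h⟩)
  · rintro x y ⟨i, h⟩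
    exact ⟨i, by rw [sumCongr_zpow]; exact congrArg Sum.inl h⟩
  · rintro x y ⟨i, h⟩
    exact ⟨i, by rw [sumCongr_zpow]; exact congrArg Sum.inr h⟩
  · rintro ⟨x | x⟩ <;> rfl
  · rintro (⟨⟨x⟩⟩ | ⟨⟨x⟩⟩) <;> rfl

/-- Cycles can be counted through any function that is constant on cycles and separates them. -/
theorem cycleCount_eq_card_image {α ι : Type} [Fintype α] [DecidableEq ι] (σ : Equiv.Perm α)
    (r : α → ι) (h₁ : ∀ x, r (σ x) = r x) (h₂ : ∀ x y, r x = r y → σ.SameCycle x y) :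
    cycleCount σ = (Finset.univ.image r).card := by
  have key : ∀ x y, σ.SameCycle x y ↔ r x = r y := by
    refine fun x y => ⟨?_, h₂ x y⟩
    rintro ⟨i, rfl⟩
    have hp : ∀ (n : ℕ) x, r ((σ ^ n) x) = r x := by
      intro n
      induction n with
      | zero => simp
      | succ n ih => intro x; rw [pow_succ', Equiv.Perm.mul_apply, h₁, ih]
    cases i with
    | ofNat n => exact (hp n x).symm
    | negSucc n =>
      have h := hp (n + 1) ((σ ^ (n + 1))⁻¹ x)
      rwa [← Equiv.Perm.mul_apply, mul_inv_cancel, Equiv.Perm.one_apply] at h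
  have hr : Nat.card (Set.range r) = (Finset.univ.image r).card := by
    rw [← Set.ncard_coe_finset, Finset.coe_image, Finset.coe_univ, Set.image_univ]
    rfl
  rw [← hr]
  refine Nat.card_congr (Equiv.ofBijective
    (Quotient.lift (fun x => (⟨r x, x, rfl⟩ : Set.range r))
      fun x y h => Subtype.ext ((key x y).1 h))
    ⟨?_, ?_⟩)
  · rintro ⟨x⟩ ⟨y⟩ h
    exact Quotient.sound ((key x y).2 (congrArg Subtype.val h))
  · rintro ⟨_, x, rfl⟩
    exact ⟨Quotient.mk _ x, rfl⟩

/-! ### Circuits of valency two -/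

/-- The permutation of the ports `(v, i)` that adds `c v` to the label of each port at `v`. -/
def twist {V : Type} (c : V → Fin 2) : Equiv.Perm (V × Fin 2) :=
  Equiv.prodShear (Equiv.refl V) fun v => Equiv.addRight (c v)

@[simp] theorem twist_apply {V : Type} (c : V → Fin 2) (p : V × Fin 2) :
    twist c p = (p.1, p.2 + c p.1) := rfl

theorem perm_two_eq_addRight (σ : Equiv.Perm (Fin 2)) : σ = Equiv.addRight (σ 0) := by
  revert σ; decide

/-- A circuit all of whose vertices have valency two, on the vertices `0, …, size - 1`. Vertices
with the same key are equivalent; the edge that leaves `v` with label `i` enters `w` with label `j`,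
where `(w, j) = wire (v, i)`. -/
structure Gadget where
  /-- the number of vertices -/
  size : ℕ
  /-- the name of the class of a vertex -/
  key : Fin size → ℕ
  /-- the edges, as a bijection from out-ports to in-ports -/
  wire : Equiv.Perm (Fin size × Fin 2)

/-- The edges that a parametrisation by `V × L` puts at `v`, numbered by `L`. -/
def fiberEquiv {E V L : Type} (ψ : E ≃ V × L) (v : V) : {e : E // (ψ e).1 = v} ≃ L where
  toFun e := (ψ e.1).2
  invFun l := ⟨ψ.symm (v, l), by simp⟩
  left_inv := by rintro ⟨e, rfl⟩; simp
  right_inv l := by simp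

namespace Gadget

/-- The polarised switching circuit of a gadget; the edge that leaves `v` with label `i` has the
number `2 v + i`. -/
def circuit (g : Gadget) : PolarisedCircuit (Fin g.size) (Fin (g.size * 2)) where
  src e := (finProdFinEquiv.symm e).1
  tgt e := (finProdFinEquiv.symm.trans g.wire e).1
  valency _ := 2
  outLabel := fiberEquiv finProdFinEquiv.symm
  inLabel := fiberEquiv (finProdFinEquiv.symm.trans g.wire)
  pol := Setoid.ker g.key
  valency_eq _ := rfl

/-- The number of cycles of the routing that swaps the labels at the vertices whose key is mapped
to `1` by `b`. -/
noncomputable def cycles (g : Gadget) (b : ℕ → Fin 2) : ℕ :=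
  cycleCount (g.wire.trans (twist (b ∘ g.key)))

/-- The routing that swaps the labels at the vertices whose key is mapped to `1` by `b`. -/
def routing (g : Gadget) (b : ℕ → Fin 2) : g.circuit.Routing :=
  fun v => (Equiv.addRight (b (g.key v)) : Equiv.Perm (Fin 2))

theorem respects_routing (g : Gadget) (b : ℕ → Fin 2) : g.circuit.Respects (g.routing b) := by
  intro u v h
  have h : g.key u = g.key v := h
  have hr : g.routing b v = g.routing b u :=
    congrArg (fun k => (Equiv.addRight (b k) : Equiv.Perm (Fin 2))) h.symm
  exact hr.trans rfl

theorem numCycles_routing (g : Gadget) (b : ℕ → Fin 2) :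
    g.circuit.numCycles (g.routing b) = g.cycles b := by
  have h : g.circuit.next (g.routing b) =
      finProdFinEquiv.permCongr (g.wire.trans (twist (b ∘ g.key))) := rfl
  unfold PolarisedCircuit.numCycles cycles
  rw [h]
  exact cycleCount_permCongr _ _

/-- Every routing that respects the classes is given by a function of the keys. -/
theorem exists_eq_routing (g : Gadget) (ρ : g.circuit.Routing) (h : g.circuit.Respects ρ) :
    ∃ b : ℕ → Fin 2, ρ = g.routing b := by
  classical
  refine ⟨fun k => if h : ∃ v, g.key v = k then ρ h.choose (0 : Fin 2) else 0, ?_⟩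
  funext v
  have hv : ∃ w, g.key w = g.key v := ⟨v, rfl⟩
  have h1 := h _ v hv.choose_spec
  have h2 : ρ v = ρ hv.choose := by
    rw [h1]
    rfl
  rw [h2]
  refine (perm_two_eq_addRight _).trans ?_
  exact congrArg Equiv.addRight (dif_pos (α := Fin 2) (c := ∃ w, g.key w = g.key v)
    (t := fun h => ρ h.choose (0 : Fin 2)) (e := fun _ => 0) hv).symm

/-- The empty gadget. -/
def empty : Gadget := ⟨0, Fin.elim0, Equiv.refl _⟩

/-- The ports of a union of two circuits. -/
def portEquiv (m n : ℕ) : (Fin m × Fin 2) ⊕ (Fin n × Fin 2) ≃ Fin (m + n) × Fin 2 :=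
  (Equiv.sumProdDistrib _ _ _).symm.trans (finSumFinEquiv.prodCongr (Equiv.refl _))

/-- The disjoint union of two gadgets. -/
def append (g h : Gadget) : Gadget :=
  ⟨g.size + h.size, Fin.append g.key h.key,
    (portEquiv _ _).permCongr (Equiv.sumCongr g.wire h.wire)⟩

/-- The disjoint union of a list of gadgets. -/
def join (l : List Gadget) : Gadget := l.foldr append empty

@[simp] theorem join_cons (g : Gadget) (l : List Gadget) : join (g :: l) = g.append (join l) := rfl

theorem cycles_empty (b : ℕ → Fin 2) : empty.cycles b = 0 := by
  have : IsEmpty (Fin empty.size × Fin 2) := ⟨fun x => x.1.elim0⟩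
  unfold cycles cycleCount
  exact Finite.card_eq_zero_iff.2 ⟨fun q => Quotient.inductionOn q this.false⟩

theorem append_wire_castAdd (g h : Gadget) (v : Fin g.size) (i : Fin 2) :
    (g.append h).wire (Fin.castAdd h.size v, i) =
      (Fin.castAdd h.size (g.wire (v, i)).1, (g.wire (v, i)).2) := by
  change (portEquiv _ _) (Equiv.sumCongr g.wire h.wire
    ((portEquiv _ _).symm (portEquiv _ _ (Sum.inl (v, i))))) = _
  rw [Equiv.symm_apply_apply]
  rfl

theorem append_wire_natAdd (g h : Gadget) (v : Fin h.size) (i : Fin 2) :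
    (g.append h).wire (Fin.natAdd g.size v, i) =
      (Fin.natAdd g.size (h.wire (v, i)).1, (h.wire (v, i)).2) := by
  change (portEquiv _ _) (Equiv.sumCongr g.wire h.wire
    ((portEquiv _ _).symm (portEquiv _ _ (Sum.inr (v, i))))) = _
  rw [Equiv.symm_apply_apply]
  rfl

theorem append_key_castAdd (g h : Gadget) (v : Fin g.size) :
    (g.append h).key (Fin.castAdd h.size v) = g.key v := Fin.append_left _ _ _

theorem append_key_natAdd (g h : Gadget) (v : Fin h.size) :
    (g.append h).key (Fin.natAdd g.size v) = h.key v := Fin.append_right _ _ _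

theorem cycles_append (g h : Gadget) (b : ℕ → Fin 2) :
    (g.append h).cycles b = g.cycles b + h.cycles b := by
  unfold cycles
  rw [← cycleCount_sumCongr, ← cycleCount_permCongr (portEquiv g.size h.size)]
  congr 1
  ext1 p
  obtain ⟨p, rfl⟩ := (portEquiv g.size h.size).surjective p
  refine Eq.trans ?_ (congrArg (fun q => portEquiv _ _ (Equiv.sumCongr _ _ q))
    ((portEquiv g.size h.size).symm_apply_apply p).symm)
  rcases p with ⟨v, i⟩ | ⟨v, i⟩
  · change twist _ ((g.append h).wire (Fin.castAdd h.size v, i)) = _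
    rw [append_wire_castAdd]
    exact Prod.ext rfl (congrArg (fun k => (g.wire (v, i)).2 + b k) (append_key_castAdd g h _))
  · change twist _ ((g.append h).wire (Fin.natAdd g.size v, i)) = _
    rw [append_wire_natAdd]
    exact Prod.ext rfl (congrArg (fun k => (h.wire (v, i)).2 + b k) (append_key_natAdd g h _))

theorem cycles_join (l : List Gadget) (b : ℕ → Fin 2) :
    (join l).cycles b = (l.map fun g => g.cycles b).sum := by
  induction l with
  | nil => exact cycles_empty b
  | cons g l ih => rw [join_cons, cycles_append, ih, List.map_cons, List.sum_cons]

theorem size_join (l : List Gadget) : (join l).size = (l.map size).sum := by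
  induction l with
  | nil => rfl
  | cons g l ih => rw [join_cons, List.map_cons, List.sum_cons, ← ih]; rfl

/-- The keys of the vertices of a gadget, in order. -/
def keys (g : Gadget) : List ℕ := List.ofFn g.key

@[simp] theorem length_keys (g : Gadget) : g.keys.length = g.size := List.length_ofFn

theorem keys_append (g h : Gadget) : (g.append h).keys = g.keys ++ h.keys :=
  List.ofFn_fin_append _ _

theorem keys_join (l : List Gadget) : (join l).keys = l.flatMap keys := by
  induction l with
  | nil => rfl
  | cons g l ih => rw [join_cons, keys_append, ih, List.flatMap_cons]

/-- The edges that leave a vertex, when the vertices of the gadget are numbered from `B`: for each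
of them the two ends and their labels. -/
def vertexEdges (g : Gadget) (B : ℕ) (v : Fin g.size) : List ℕ :=
  [B + v, 0, B + (g.wire (v, 0)).1, (g.wire (v, 0)).2,
    B + v, 1, B + (g.wire (v, 1)).1, (g.wire (v, 1)).2]

/-- The edges of a gadget, when its vertices are numbered from `B`. -/
def edges (g : Gadget) (B : ℕ) : List ℕ := (List.ofFn (g.vertexEdges B)).flatten

theorem edges_append (g h : Gadget) (B : ℕ) :
    (g.append h).edges B = g.edges B ++ h.edges (B + g.size) := by
  unfold edges
  rw [← List.flatten_append, ← List.ofFn_fin_append]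
  congr 2
  funext v
  refine Fin.addCases (fun v => ?_) (fun v => ?_) v
  · rw [Fin.append_left]
    simp only [vertexEdges, append_wire_castAdd, Fin.val_castAdd]
  · rw [Fin.append_right]
    simp only [vertexEdges, append_wire_natAdd, Fin.val_natAdd, add_assoc]

/-- The edges of a disjoint union of gadgets, numbered from `B`. -/
def joinEdges : ℕ → List Gadget → List ℕ
  | _, [] => []
  | B, g :: l => g.edges B ++ joinEdges (B + g.size) l

theorem joinEdges_append (B : ℕ) (l l' : List Gadget) :
    joinEdges B (l ++ l') = joinEdges B l ++ joinEdges (B + (l.map size).sum) l' := by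
  induction l generalizing B with
  | nil => simp [joinEdges]
  | cons g l ih => simp [joinEdges, ih, add_assoc]

theorem edges_join (l : List Gadget) (B : ℕ) : (join l).edges B = joinEdges B l := by
  induction l generalizing B with
  | nil => rfl
  | cons g l ih => rw [join_cons, edges_append, ih, joinEdges]

/-- An instance of maximal routing whose circuit is a gadget. -/
def toInstance (g : Gadget) (K : ℕ) (hK : 0 < K) : RoutingInstance :=
  ⟨g.size, g.size * 2, g.circuit, K, hK⟩

theorem edgeData_toInstance (g : Gadget) (K : ℕ) (hK : 0 < K) :
    (List.ofFn (g.toInstance K hK).edgeData).flatten = g.edges 0 := by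
  unfold edges
  have h : List.ofFn (g.toInstance K hK).edgeData =
      (List.ofFn fun v : Fin g.size => List.ofFn fun i : Fin 2 =>
        [(v : ℕ), (i : ℕ), ((g.wire (v, i)).1 : ℕ), ((g.wire (v, i)).2 : ℕ)]).flatten := by
    refine (List.ofFn_mul (m := g.size) (n := 2) _).trans ?_
    congr 2
    funext v
    congr 1
    funext i
    have hp : (⟨v * 2 + i, by have := v.2; have := i.2; omega⟩ : Fin (g.size * 2)) =
        finProdFinEquiv (v, i) := by
      ext; simp [finProdFinEquiv]; ring
    rw [hp]
    change [((finProdFinEquiv.symm (finProdFinEquiv (v, i))).1 : ℕ),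
      ((finProdFinEquiv.symm (finProdFinEquiv (v, i))).2 : ℕ),
      ((g.wire (finProdFinEquiv.symm (finProdFinEquiv (v, i)))).1 : ℕ),
      ((g.wire (finProdFinEquiv.symm (finProdFinEquiv (v, i)))).2 : ℕ)] = _
    rw [Equiv.symm_apply_apply]
  rw [h]
  simp only [List.flatten_flatten, List.map_ofFn]
  congr 2
  funext v
  simp [vertexEdges]

/-- A key that names the least vertex of its class. -/
def Standard (g : Gadget) : Prop :=
  ∀ v : Fin g.size, g.key v ≤ v ∧ ∃ w : Fin g.size, (w : ℕ) = g.key v ∧ g.key w = g.key v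

theorem classRep_toInstance (g : Gadget) (hg : g.Standard) (K : ℕ) (hK : 0 < K) :
    (g.toInstance K hK).classRep = g.key := by
  funext v
  refine le_antisymm (Nat.sInf_le ?_) (le_csInf ⟨v, v, rfl, rfl⟩ ?_)
  · obtain ⟨w, hw, hw'⟩ := (hg v).2
    exact ⟨w, hw', hw⟩
  · rintro n ⟨u, hu, rfl⟩
    have hu : g.key u = g.key v := hu
    exact hu ▸ (hg u).1

theorem encode_toInstance (g : Gadget) (hg : g.Standard) (K : ℕ) (hK : 0 < K) :
    (g.toInstance K hK).encode = encodeNats (g.size :: (g.keys ++ (g.edges 0 ++ [K]))) := by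
  unfold RoutingInstance.encode
  rw [edgeData_toInstance, classRep_toInstance g hg]
  rfl

theorem widthLE_circuit (g : Gadget) (w : ℕ) (h : ∀ k, g.keys.count k ≤ w) :
    g.circuit.WidthLE w := by
  intro u
  refine le_trans (le_of_eq ?_) (h (g.key u))
  have h1 : g.keys.count (g.key u) = (Finset.univ.filter fun v => g.key v = g.key u).card := by
    rw [keys, ← Multiset.coe_count, ← Fin.univ_val_map, Multiset.count_map]
    simp only [eq_comm (a := g.key u)]
    rfl
  rw [h1, ← Fintype.card_subtype, ← Nat.card_eq_fintype_card]
  exact Nat.card_congr (Equiv.subtypeEquivRight fun v => eq_comm)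

end Gadget

/-! ### Gadgets for clauses and for equivalences -/

namespace Gadget

/-- The least code of the first `m + 1` elements of the cycle of a port; the code of `(v, i)` is
`2 v + i`. -/
def orbitMin {n : ℕ} (σ : Equiv.Perm (Fin n × Fin 2)) : ℕ → Fin n × Fin 2 → ℕ
  | 0, p => 2 * p.1 + p.2
  | m + 1, p => min (2 * p.1 + p.2) (orbitMin σ m (σ p))

theorem exists_code_eq_orbitMin {n : ℕ} (σ : Equiv.Perm (Fin n × Fin 2)) (m : ℕ) (p) :
    ∃ q, σ.SameCycle p q ∧ 2 * (q.1 : ℕ) + q.2 = orbitMin σ m p := by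
  induction m generalizing p with
  | zero => exact ⟨p, .refl _ _, rfl⟩
  | succ m ih =>
    obtain ⟨q, hq, h⟩ := ih (σ p)
    rcases min_choice (2 * (p.1 : ℕ) + p.2) (orbitMin σ m (σ p)) with h' | h'
    · exact ⟨p, .refl _ _, h'.symm⟩
    · exact ⟨q, (Equiv.Perm.sameCycle_apply_left.1 hq), h.trans h'.symm⟩

/-- If `m` is large enough for `orbitMin σ m` to be constant on cycles, it counts the cycles. -/
theorem cycleCount_eq_card_orbitMin {n : ℕ} (σ : Equiv.Perm (Fin n × Fin 2)) (m : ℕ)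
    (h : ∀ p, orbitMin σ m (σ p) = orbitMin σ m p) :
    cycleCount σ = (Finset.univ.image (orbitMin σ m)).card := by
  refine cycleCount_eq_card_image σ _ h fun x y hxy => ?_
  obtain ⟨p, hp, hp'⟩ := exists_code_eq_orbitMin σ m x
  obtain ⟨q, hq, hq'⟩ := exists_code_eq_orbitMin σ m y
  have hpq : p = q := by
    have := p.2.2
    have := q.2.2
    exact Prod.ext (Fin.ext (by omega)) (Fin.ext (by omega))
  exact hp.trans (hpq ▸ hq.symm)

/-- Two vertices on two cycles, as the word `x y x y | x' x' y' y'` in the vertices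
`0, 1, 2, 3 = x, y, x', y'`; the `i`-th visit to a vertex uses the ports with label `i`. -/
def wireTwo : Equiv.Perm (Fin 4 × Fin 2) where
  toFun p := ![![(1, 0), (1, 1)], ![(0, 1), (0, 0)], ![(2, 1), (3, 0)], ![(3, 1), (2, 0)]] p.1 p.2
  invFun p := ![![(1, 1), (1, 0)], ![(0, 0), (0, 1)], ![(3, 1), (2, 0)], ![(2, 1), (3, 0)]] p.1 p.2
  left_inv := by decide
  right_inv := by decide

/-- Six vertices on a single cycle, as the word `z y z x y z' x z' x' x' y' y'` in the vertices
`0, …, 5 = x, y, z, x', y', z'`; the `i`-th visit to a vertex uses the ports with label `i`.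
The word visits two vertices alternatingly if they are adjacent in the path `z - y - x - z'`, and
no other two vertices. -/
def wireThree : Equiv.Perm (Fin 6 × Fin 2) where
  toFun p := ![![(1, 1), (5, 1)], ![(2, 1), (5, 0)], ![(1, 0), (0, 0)], ![(3, 1), (4, 0)],
    ![(4, 1), (2, 0)], ![(0, 1), (3, 0)]] p.1 p.2
  invFun p := ![![(2, 1), (5, 0)], ![(2, 0), (0, 0)], ![(4, 1), (1, 0)], ![(5, 1), (3, 0)],
    ![(3, 1), (4, 0)], ![(1, 1), (0, 1)]] p.1 p.2
  left_inv := by decide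
  right_inv := by decide

theorem cycleCount_wireOne (a : Fin 2) :
    cycleCount ((twist fun _ : Fin 1 => 1).trans (twist ![a])) = if a = 1 then 2 else 1 := by
  rw [cycleCount_eq_card_orbitMin _ 1 (by revert a; decide)]
  revert a; decide

theorem cycleCount_wireTwo (a b : Fin 2) :
    cycleCount (wireTwo.trans (twist ![a, b, a, b])) = if a = 1 ∨ b = 1 then 4 else 2 := by
  rw [cycleCount_eq_card_orbitMin _ 3 (by revert a b; decide +kernel)]
  revert a b; decide +kernel

theorem cycleCount_wireThree (a b c : Fin 2) :
    cycleCount (wireThree.trans (twist ![a, b, c, a, b, c])) =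
      if a = 1 ∨ b = 1 ∨ c = 1 then 3 else 1 := by
  rw [cycleCount_eq_card_orbitMin _ 11 (by revert a b c; decide +kernel)]
  revert a b c; decide +kernel

theorem cycleCount_wireEq (a b : Fin 2) :
    cycleCount (((Equiv.addRight (1 : Fin 2)).prodCongr (Equiv.refl (Fin 2))).trans
      (twist ![a, b])) = if a = b then 2 else 1 := by
  rw [cycleCount_eq_card_orbitMin _ 3 (by revert a b; decide)]
  revert a b; decide

/-- The number of vertices of the gadget of a clause with `n` literals. -/
def clauseSize : ℕ → ℕ
  | 0 => 0
  | 1 => 1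
  | 2 => 4
  | _ + 3 => 6

/-- The number of cycles that the gadget of a clause with `n` literals has if the clause is
satisfied. It is never reached for the empty clause. -/
def clauseWeight : ℕ → ℕ
  | 0 => 1
  | 1 => 2
  | 2 => 4
  | _ + 3 => 3

/-- The edges of the gadget of a clause with `n` literals, all of them positive. -/
def clauseWire : (n : ℕ) → Equiv.Perm (Fin (clauseSize n) × Fin 2)
  | 0 => Equiv.refl _
  | 1 => twist fun _ => 1
  | 2 => wireTwo
  | _ + 3 => wireThree

/-- The gadget of a clause with the given signs of its literals; the vertices for the `i`-th
literal have the key `B + i`. At the vertices of a negated literal the labels of the incoming edges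
are swapped. -/
def clauseGadget (B : ℕ) (s : List Bool) : Gadget where
  size := clauseSize s.length
  key v := B + v % s.length
  wire := (clauseWire s.length).trans (twist fun v => if s.getD (v % s.length) true then 0 else 1)

/-- The bit of a truth value. -/
def toBit (p : Bool) : Fin 2 := if p then 1 else 0

theorem trans_twist_trans_twist {V : Type} (w : Equiv.Perm (V × Fin 2)) (c d : V → Fin 2) :
    (w.trans (twist c)).trans (twist d) = w.trans (twist (c + d)) := by
  ext p <;> simp [add_assoc]

theorem sign_add_eq_one_iff (p : Bool) (a : Fin 2) :
    (if p then 0 else 1) + a = 1 ↔ a = toBit p := by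
  revert p a; decide

/-- The gadget of a clause has at most `clauseWeight` cycles, and this many if and only if one of
the literals is true. -/
theorem cycles_clauseGadget (B : ℕ) (s : List Bool) (hs : s.length ≤ 3) (b : ℕ → Fin 2) :
    (clauseGadget B s).cycles b ≤ clauseWeight s.length ∧
      ((clauseGadget B s).cycles b = clauseWeight s.length ↔
        ∃ x ∈ s.zipIdx B, b x.2 = toBit x.1) := by
  have key : (clauseGadget B s).cycles b = cycleCount ((clauseWire s.length).trans
      (twist fun v => (if s.getD (v % s.length) true then 0 else 1) + b (B + v % s.length))) :=
    congrArg cycleCount (trans_twist_trans_twist _ _ _)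
  rcases s with _ | ⟨p, _ | ⟨q, _ | ⟨r, _ | ⟨_, _⟩⟩⟩⟩
  · have : (clauseGadget B []).cycles b = 0 := by
      have : IsEmpty (Fin (clauseGadget B []).size × Fin 2) := ⟨fun x => x.1.elim0⟩
      exact Finite.card_eq_zero_iff.2 ⟨fun q => Quotient.inductionOn q this.false⟩
    simp [this, clauseWeight]
  · have h : (clauseGadget B [p]).cycles b = _ := key.trans <| Eq.trans
      (congrArg (fun c => cycleCount ((twist fun _ : Fin 1 => 1).trans (twist c))) (by
        funext v; fin_cases v; rfl))
      (cycleCount_wireOne ((if p then 0 else 1) + b B))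
    simp only [sign_add_eq_one_iff] at h
    rw [h]
    by_cases hb : b B = toBit p <;> simp [hb, clauseWeight]
  · have h : (clauseGadget B [p, q]).cycles b = _ := key.trans <| Eq.trans
      (congrArg (fun c => cycleCount (wireTwo.trans (twist c))) (by
        funext v; fin_cases v <;> simp <;> rfl))
      (cycleCount_wireTwo ((if p then 0 else 1) + b B) ((if q then 0 else 1) + b (B + 1)))
    simp only [sign_add_eq_one_iff] at h
    rw [h]
    by_cases hb : b B = toBit p ∨ b (B + 1) = toBit q <;> simp [hb, clauseWeight]
  · have h : (clauseGadget B [p, q, r]).cycles b = _ := key.trans <| Eq.trans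
      (congrArg (fun c => cycleCount (wireThree.trans (twist c))) (by
        funext v; fin_cases v <;> simp <;> rfl))
      (cycleCount_wireThree ((if p then 0 else 1) + b B) ((if q then 0 else 1) + b (B + 1))
        ((if r then 0 else 1) + b (B + 2)))
    simp only [sign_add_eq_one_iff] at h
    rw [h]
    by_cases hb : b B = toBit p ∨ b (B + 1) = toBit q ∨ b (B + 2) = toBit r <;>
      simp [hb, clauseWeight, add_assoc]
  · simp only [List.length_cons] at hs
    omega

/-- A gadget that has two cycles if the classes with keys `p` and `q` carry the same permutation,
and one cycle otherwise. -/
def eqGadget (p q : ℕ) : Gadget where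
  size := 2
  key := ![p, q]
  wire := (Equiv.addRight (1 : Fin 2)).prodCongr (Equiv.refl (Fin 2))

theorem cycles_eqGadget (p q : ℕ) (b : ℕ → Fin 2) :
    (eqGadget p q).cycles b = if b p = b q then 2 else 1 := by
  refine Eq.trans ?_ (cycleCount_wireEq (b p) (b q))
  refine congrArg (fun c => cycleCount (((Equiv.addRight (1 : Fin 2)).prodCongr
    (Equiv.refl (Fin 2))).trans (twist c))) ?_
  funext v; fin_cases v <;> rfl

/-- The keys of the vertices of the gadget of a clause with `n` literals. -/
def clauseKeys (B : ℕ) : ℕ → List ℕ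
  | 0 => []
  | 1 => [B]
  | 2 => [B, B + 1, B, B + 1]
  | _ + 3 => [B, B + 1, B + 2, B, B + 1, B + 2]

theorem keys_clauseGadget (B : ℕ) (s : List Bool) (hs : s.length ≤ 3) :
    (clauseGadget B s).keys = clauseKeys B s.length := by
  rcases s with _ | ⟨p, _ | ⟨q, _ | ⟨r, _ | ⟨_, _⟩⟩⟩⟩
  · rfl
  · rfl
  · simp [keys, clauseGadget, clauseKeys, clauseSize, List.ofFn_succ]
  · simp [keys, clauseGadget, clauseKeys, clauseSize, List.ofFn_succ]
  · simp only [List.length_cons] at hs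
    omega

end Gadget

/-! ### Identifying the occurrences of each variable -/

/-- The pairs of consecutive elements of `a :: l`. -/
def chain : ℕ → List ℕ → List (ℕ × ℕ)
  | _, [] => []
  | a, b :: l => (a, b) :: chain b l

/-- The occurrences of the variable `x` in a list of entries `(variable, occurrence)`. -/
def occurrencesOf (x : ℕ) (L : List (ℕ × ℕ)) : List ℕ := (L.filter fun e => e.1 = x).map Prod.snd

/-- The entries of the variables other than `x`, in reverse order. -/
def otherEntries (x : ℕ) (L : List (ℕ × ℕ)) : List (ℕ × ℕ) := (L.filter fun e => e.1 ≠ x).reverse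

theorem length_otherEntries_le (x : ℕ) (L : List (ℕ × ℕ)) :
    (otherEntries x L).length ≤ L.length := by
  rw [otherEntries, List.length_reverse]
  exact List.length_filter_le _ _

theorem length_occurrencesOf_add (x : ℕ) (L : List (ℕ × ℕ)) :
    (occurrencesOf x L).length + (otherEntries x L).length = L.length := by
  have := List.length_eq_length_filter_add (l := L) fun e : ℕ × ℕ => decide (e.1 = x)
  simp only [← decide_not] at this
  rw [occurrencesOf, otherEntries, List.length_map, List.length_reverse, ← this]

/-- Given entries `(x, r)`, where `r` names an occurrence of the variable `x`, this lists for each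
variable the pairs of consecutive occurrences, which is a path through its occurrences. The entries
of the first variable are taken out, in order; the other ones are reversed before the recursion. -/
def equivPairs : List (ℕ × ℕ) → List (ℕ × ℕ)
  | [] => []
  | (x, r) :: L => chain r (occurrencesOf x L) ++ equivPairs (otherEntries x L)
termination_by L => L.length
decreasing_by
  exact Nat.lt_succ_of_le (length_otherEntries_le _ _)

theorem length_chain (a : ℕ) (l : List ℕ) : (chain a l).length = l.length := by
  induction l generalizing a with
  | nil => rfl
  | cons b l ih => rw [chain, List.length_cons, ih, List.length_cons]

theorem chain_respected_iff {β : Type} (b : ℕ → β) (a : ℕ) (l : List ℕ) :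
    (∀ p ∈ chain a l, b p.1 = b p.2) ↔ ∀ c ∈ l, b c = b a := by
  induction l generalizing a with
  | nil => simp [chain]
  | cons d l ih =>
    simp only [chain, List.forall_mem_cons, ih]
    constructor
    · rintro ⟨h, h'⟩
      exact ⟨h.symm, fun c hc => (h' c hc).trans h.symm⟩
    · rintro ⟨h, h'⟩
      exact ⟨h.symm, fun c hc => (h' c hc).trans h.symm⟩

/-- The pairs force `b` to be constant on the occurrences of each variable, and nothing else. -/
theorem equivPairs_respected_iff {β : Type} [Inhabited β] (b : ℕ → β) (L : List (ℕ × ℕ)) :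
    (∀ p ∈ equivPairs L, b p.1 = b p.2) ↔ ∃ α : ℕ → β, ∀ e ∈ L, b e.2 = α e.1 := by
  induction L using equivPairs.induct with
  | case1 => simp [equivPairs]
  | case2 x r L ih =>
    rw [equivPairs, List.forall_mem_append, chain_respected_iff, ih]
    simp only [occurrencesOf, otherEntries, List.mem_map, List.mem_filter, List.mem_reverse,
      decide_eq_true_eq]
    constructor
    · rintro ⟨h, α, hα⟩
      refine ⟨Function.update α x (b r), fun e he => ?_⟩
      rcases List.mem_cons.1 he with rfl | he
      · simp
      by_cases hx : e.1 = x
      · rw [hx, Function.update_self]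
        exact h _ ⟨e, ⟨he, hx⟩, rfl⟩
      · rw [Function.update_of_ne hx]
        exact hα e ⟨he, hx⟩
    · rintro ⟨α, hα⟩
      have hr := hα _ List.mem_cons_self
      refine ⟨?_, α, fun e he => hα e (List.mem_cons_of_mem _ he.1)⟩
      rintro _ ⟨e, ⟨he, rfl⟩, rfl⟩
      rw [hα e (List.mem_cons_of_mem _ he)]
      exact hr.symm

theorem count_chain_le (k a : ℕ) (l : List ℕ) :
    ((chain a l).flatMap fun p => [p.1, p.2]).count k + (if a = k then 1 else 0) ≤
      2 * (a :: l).count k := by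
  induction l generalizing a with
  | nil => simp [chain, List.count_cons]; split_ifs <;> simp
  | cons b l ih =>
    have := ih b
    simp only [chain, List.flatMap_cons, List.count_append, List.count_cons, List.count_nil,
      beq_iff_eq] at *
    split_ifs at * <;> omega

/-- An occurrence takes part in at most two pairs. -/
theorem count_equivPairs_le (k : ℕ) (L : List (ℕ × ℕ)) :
    ((equivPairs L).flatMap fun p => [p.1, p.2]).count k ≤ 2 * (L.map Prod.snd).count k := by
  induction L using equivPairs.induct with
  | case1 => simp [equivPairs]
  | case2 x r L ih =>
    rw [equivPairs, List.flatMap_append, List.count_append]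
    have h1 := count_chain_le k r (occurrencesOf x L)
    have h2 : (L.map Prod.snd).count k = (occurrencesOf x L).count k +
        ((L.filter fun e => e.1 ≠ x).map Prod.snd).count k := by
      rw [occurrencesOf, ← List.count_append, ← List.map_append]
      refine (List.Perm.map _ ?_).count_eq k
      have := (List.filter_append_perm (fun e : ℕ × ℕ => decide (e.1 = x)) L).symm
      simpa only [decide_not] using this
    rw [otherEntries, List.map_reverse, List.count_reverse] at ih
    rw [otherEntries]
    rw [List.map_cons, List.count_cons, h2]
    rw [List.count_cons] at h1
    have h3 : ((x, r).2 == k) = (r == k) := rfl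
    rw [h3]
    omega

theorem mem_of_mem_equivPairs {L : List (ℕ × ℕ)} {p : ℕ × ℕ} (h : p ∈ equivPairs L) :
    p.1 ∈ L.map Prod.snd ∧ p.2 ∈ L.map Prod.snd := by
  have key : ∀ k ∈ (equivPairs L).flatMap fun p => [p.1, p.2], k ∈ L.map Prod.snd := by
    intro k hk
    have := count_equivPairs_le k L
    have := List.count_pos_iff.2 hk
    exact List.count_pos_iff.1 (by omega)
  exact ⟨key _ (List.mem_flatMap.2 ⟨p, h, by simp⟩), key _ (List.mem_flatMap.2 ⟨p, h, by simp⟩)⟩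

theorem length_equivPairs (L : List (ℕ × ℕ)) :
    (equivPairs L).length =
      ∑ x ∈ (L.map Prod.fst).toFinset, ((L.map Prod.fst).count x - 1) := by
  induction L using equivPairs.induct with
  | case1 => simp [equivPairs]
  | case2 x r L ih =>
    set M := L.filter fun e => e.1 ≠ x with hM
    have hx : x ∉ (M.map Prod.fst).toFinset := by
      simp only [hM, List.mem_toFinset, List.mem_map, List.mem_filter, decide_eq_true_eq]
      rintro ⟨e, he, h⟩
      exact he.2 h
    have hins : (((x, r) :: L).map Prod.fst).toFinset = insert x (M.map Prod.fst).toFinset := by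
      ext y
      simp only [hM, List.mem_toFinset, List.mem_map, List.mem_filter, decide_eq_true_eq,
        Finset.mem_insert, List.mem_cons]
      constructor
      · rintro ⟨e, rfl | he, rfl⟩
        · exact Or.inl rfl
        · by_cases h : e.1 = x
          · exact Or.inl h
          · exact Or.inr ⟨e, ⟨he, h⟩, rfl⟩
      · rintro (rfl | ⟨e, he, rfl⟩)
        · exact ⟨_, Or.inl rfl, rfl⟩
        · exact ⟨e, Or.inr he.1, rfl⟩
    rw [hins, Finset.sum_insert hx, equivPairs, List.length_append, length_chain, ih]
    rw [otherEntries, List.map_reverse, List.toFinset_reverse]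
    congr 1
    · rw [List.map_cons, List.count_cons_self, Nat.add_sub_cancel, occurrencesOf, List.length_map,
        ← List.countP_eq_length_filter, List.count, List.countP_map]
      rfl
    · refine Finset.sum_congr rfl fun y hy => ?_
      have hyx : y ≠ x := fun h => hx (h ▸ hy)
      rw [List.count_reverse, List.map_cons, List.count_cons_of_ne hyx.symm]
      congr 1
      simp only [List.count]
      rw [List.countP_map, List.countP_map, List.countP_filter]
      refine List.countP_congr fun e _ => ?_
      by_cases h : e.1 = y <;> simp [h, hyx]

theorem length_equivPairs_le (L : List (ℕ × ℕ)) : (equivPairs L).length ≤ L.length := by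
  induction L using equivPairs.induct with
  | case1 => simp [equivPairs]
  | case2 x r L ih =>
    have := length_occurrencesOf_add x L
    rw [equivPairs, List.length_append, length_chain, List.length_cons]
    omega

/-! ### The circuit of a formula -/

namespace Gadget

/-- The gadgets of the clauses, when the vertices are numbered from `B`. -/
def clauseGadgets : ℕ → List (List Literal) → List Gadget
  | _, [] => []
  | B, C :: l =>
    clauseGadget B (C.map Literal.positive) :: clauseGadgets (B + clauseSize C.length) l

/-- The occurrences of the variables in the clauses, each with the key of its vertices, when the
vertices are numbered from `B`. -/
def clauseEntries : ℕ → List (List Literal) → List (ℕ × ℕ)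
  | _, [] => []
  | B, C :: l => (C.map Literal.var).zipIdx B ++ clauseEntries (B + clauseSize C.length) l

/-- The equivalences that identify the occurrences of each variable. -/
def formulaPairs (l : List (List Literal)) : List (ℕ × ℕ) :=
  equivPairs (clauseEntries 0 l).reverse

/-- The gadgets of a formula. -/
def formulaGadgets (l : List (List Literal)) : List Gadget :=
  clauseGadgets 0 l ++ (formulaPairs l).map fun p => eqGadget p.1 p.2

/-- The circuit of a formula, as a gadget. -/
def formulaGadget (l : List (List Literal)) : Gadget := join (formulaGadgets l)

/-- The number of cycles asked for. -/
def formulaTarget (l : List (List Literal)) : ℕ :=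
  (l.map fun C => clauseWeight C.length).sum + 2 * (formulaPairs l).length

theorem sum_le_and_eq_iff {ι : Type} (l : List ι) (f w : ι → ℕ) (h : ∀ x ∈ l, f x ≤ w x) :
    (l.map f).sum ≤ (l.map w).sum ∧ ((l.map f).sum = (l.map w).sum ↔ ∀ x ∈ l, f x = w x) := by
  induction l with
  | nil => simp
  | cons a l ih =>
    obtain ⟨h1, h2⟩ := ih fun x hx => h x (List.mem_cons_of_mem _ hx)
    have ha := h a List.mem_cons_self
    simp only [List.map_cons, List.sum_cons, List.forall_mem_cons, ← h2]
    omega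

/-- If `b` is given on the keys by a truth assignment, then the gadgets of the clauses have at most
the sum of the weights many cycles, and this many if and only if the assignment satisfies them. -/
theorem cycles_clauseGadgets_le (B : ℕ) (l : List (List Literal)) (hl : ∀ C ∈ l, C.length ≤ 3)
    (b : ℕ → Fin 2) :
    ((clauseGadgets B l).map fun g => g.cycles b).sum ≤
        (l.map fun C => clauseWeight C.length).sum ∧
      ∀ α : ℕ → Fin 2, (∀ e ∈ clauseEntries B l, b e.2 = α e.1) →
        (((clauseGadgets B l).map fun g => g.cycles b).sum =
            (l.map fun C => clauseWeight C.length).sum ↔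
          ∀ C ∈ l, ∃ x ∈ C, α x.var = toBit x.positive) := by
  induction l generalizing B with
  | nil => simp [clauseGadgets]
  | cons C l ih =>
    obtain ⟨h1, h2⟩ := ih (B + clauseSize C.length) fun C hC => hl C (List.mem_cons_of_mem _ hC)
    obtain ⟨h3, h4⟩ := cycles_clauseGadget B (C.map Literal.positive)
      (by simpa using hl C List.mem_cons_self) b
    rw [List.length_map] at h3 h4
    simp only [clauseGadgets, clauseEntries, List.map_cons, List.sum_cons]
    refine ⟨by omega, fun α hα => ?_⟩
    rw [List.forall_mem_append] at hα
    rw [List.forall_mem_cons, ← h2 α hα.2]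
    have h5 : (∃ x ∈ (C.map Literal.positive).zipIdx B, b x.2 = toBit x.1) ↔
        ∃ x ∈ C, α x.var = toBit x.positive := by
      have h6 := hα.1
      rw [List.zipIdx_map] at h6
      rw [List.zipIdx_map]
      simp only [List.mem_map, forall_exists_index, and_imp, forall_apply_eq_imp_iff₂] at h6
      constructor
      · rintro ⟨_, hx, hb⟩
        obtain ⟨⟨x, k⟩, hx', rfl⟩ := List.mem_map.1 hx
        exact ⟨x, List.fst_mem_of_mem_zipIdx hx', (h6 _ hx').symm.trans hb⟩
      · rintro ⟨x, hx, hb⟩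
        obtain ⟨i, hi, rfl⟩ := List.mem_iff_getElem.1 hx
        have hm : (C[i], B + i) ∈ C.zipIdx B := by
          rw [List.mk_add_mem_zipIdx_iff_getElem?]
          exact List.getElem?_eq_getElem hi
        exact ⟨_, List.mem_map.2 ⟨_, hm, rfl⟩, (h6 _ hm).trans hb⟩
    rw [← h5, ← h4]
    omega

/-- The circuit of a formula has at most `formulaTarget` cycles, and this many if and only if the
swaps are given on the keys by a satisfying assignment. -/
theorem cycles_formulaGadget_le (l : List (List Literal)) (hl : ∀ C ∈ l, C.length ≤ 3)
    (b : ℕ → Fin 2) :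
    (formulaGadget l).cycles b ≤ formulaTarget l ∧
      ((formulaGadget l).cycles b = formulaTarget l ↔
        ∃ α : ℕ → Fin 2, (∀ e ∈ clauseEntries 0 l, b e.2 = α e.1) ∧
          ∀ C ∈ l, ∃ x ∈ C, α x.var = toBit x.positive) := by
  have hc : (formulaGadget l).cycles b = ((clauseGadgets 0 l).map fun g => g.cycles b).sum +
      ((formulaPairs l).map fun p => if b p.1 = b p.2 then 2 else 1).sum := by
    rw [formulaGadget, cycles_join, formulaGadgets, List.map_append, List.sum_append, List.map_map]
    congr 3
    funext p
    exact cycles_eqGadget p.1 p.2 b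
  have ht : formulaTarget l = (l.map fun C => clauseWeight C.length).sum +
      ((formulaPairs l).map fun _ => 2).sum := by
    simp [formulaTarget, mul_comm]
  obtain ⟨h1, h2⟩ := cycles_clauseGadgets_le 0 l hl b
  obtain ⟨h3, h4⟩ := sum_le_and_eq_iff (formulaPairs l)
    (fun p => if b p.1 = b p.2 then 2 else 1) (fun _ => 2) fun p _ => by split_ifs <;> simp
  have h5 : (∀ p ∈ formulaPairs l, (if b p.1 = b p.2 then 2 else 1) = 2) ↔
      ∃ α : ℕ → Fin 2, ∀ e ∈ clauseEntries 0 l, b e.2 = α e.1 := by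
    have h6 := equivPairs_respected_iff b (clauseEntries 0 l).reverse
    simp only [List.mem_reverse] at h6
    rw [← h6]
    refine forall₂_congr fun p _ => ?_
    split_ifs with h <;> simp [h]
  rw [hc, ht]
  refine ⟨by omega, ?_⟩
  constructor
  · intro h
    obtain ⟨α, hα⟩ := h5.1 (h4.1 (by omega))
    exact ⟨α, hα, (h2 α hα).1 (by omega)⟩
  · rintro ⟨α, hα, hs⟩
    rw [(h2 α hα).2 hs, h4.2 (h5.2 ⟨α, hα⟩)]

/-! ### The keys of the circuit of a formula -/

theorem keys_clauseGadgets_cons (B : ℕ) (C : List Literal) (l : List (List Literal))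
    (hC : C.length ≤ 3) :
    (clauseGadgets B (C :: l)).flatMap keys =
      clauseKeys B C.length ++ (clauseGadgets (B + clauseSize C.length) l).flatMap keys := by
  rw [clauseGadgets, List.flatMap_cons, keys_clauseGadget _ _ (by simpa using hC), List.length_map]

theorem length_clauseKeys (B n : ℕ) : (clauseKeys B n).length = clauseSize n := by
  rcases n with _ | _ | _ | n <;> rfl

theorem clauseKeys_bounds {B n k : ℕ} (h : k ∈ clauseKeys B n) : B ≤ k ∧ k < B + clauseSize n := by
  rcases n with _ | _ | _ | n <;> simp [clauseKeys, clauseSize] at * <;> omega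

theorem clauseKeys_eq (B : ℕ) {n : ℕ} (hn : n ≤ 3) :
    clauseKeys B n = List.range' B n ++ if n ≤ 1 then [] else List.range' B n := by
  interval_cases n <;> simp [clauseKeys, List.range'_succ]

theorem size_clauseGadgets (B : ℕ) (l : List (List Literal)) :
    (clauseGadgets B l).map size = l.map fun C => clauseSize C.length := by
  induction l generalizing B with
  | nil => rfl
  | cons C l ih =>
    rw [clauseGadgets, List.map_cons, List.map_cons, ih]
    simp [clauseGadget]

theorem keys_formulaGadget (l : List (List Literal)) :
    (formulaGadget l).keys = (clauseGadgets 0 l).flatMap keys ++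
      (formulaPairs l).flatMap fun p => [p.1, p.2] := by
  rw [formulaGadget, keys_join, formulaGadgets, List.flatMap_append, List.flatMap_map]
  rfl

theorem map_snd_clauseEntries_cons (B : ℕ) (C : List Literal) (l : List (List Literal)) :
    (clauseEntries B (C :: l)).map Prod.snd =
      List.range' B C.length ++ (clauseEntries (B + clauseSize C.length) l).map Prod.snd := by
  rw [clauseEntries, List.map_append, List.zipIdx_map_snd, List.length_map]

theorem map_fst_clauseEntries (B : ℕ) (l : List (List Literal)) :
    (clauseEntries B l).map Prod.fst = l.flatten.map Literal.var := by
  induction l generalizing B with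
  | nil => rfl
  | cons C l ih =>
    rw [clauseEntries, List.map_append, ih, List.flatten_cons, List.map_append, List.zipIdx_map_fst]

/-- Different occurrences have different keys. -/
theorem nodup_clauseEntries (B : ℕ) (l : List (List Literal)) (hl : ∀ C ∈ l, C.length ≤ 3) :
    ((clauseEntries B l).map Prod.snd).Nodup ∧ ∀ k ∈ (clauseEntries B l).map Prod.snd, B ≤ k := by
  induction l generalizing B with
  | nil => simp [clauseEntries]
  | cons C l ih =>
    obtain ⟨h1, h2⟩ := ih (B + clauseSize C.length) fun C hC => hl C (List.mem_cons_of_mem _ hC)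
    have hC : C.length ≤ clauseSize C.length := by
      have := hl C List.mem_cons_self
      generalize C.length = n at *
      interval_cases n <;> simp [clauseSize]
    rw [map_snd_clauseEntries_cons]
    refine ⟨List.nodup_append.2 ⟨List.nodup_range', h1, fun a ha b hb => ?_⟩, fun k hk => ?_⟩
    · have := h2 b hb
      rw [List.mem_range'_1] at ha
      omega
    · rcases List.mem_append.1 hk with hk | hk
      · exact (List.mem_range'_1.1 hk).1
      · exact le_trans (Nat.le_add_right _ _) (h2 k hk)

theorem snd_lt_of_mem_clauseEntries (B : ℕ) (l : List (List Literal)) (hl : ∀ C ∈ l, C.length ≤ 3)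
    {e : ℕ × ℕ} (he : e ∈ clauseEntries B l) :
    e.2 < B + (l.map fun C => clauseSize C.length).sum := by
  induction l generalizing B with
  | nil => simp [clauseEntries] at he
  | cons C l ih =>
    rw [List.map_cons, List.sum_cons]
    rcases List.mem_append.1 he with he | he
    · have h1 := List.snd_lt_of_mem_zipIdx he
      have h2 : ∀ n ≤ 3, n ≤ clauseSize n := by decide
      have h3 := h2 _ (hl C List.mem_cons_self)
      rw [List.length_map] at h1
      omega
    · have := ih _ (fun C hC => hl C (List.mem_cons_of_mem _ hC)) he
      omega

theorem count_keys_clauseGadgets_le (k B : ℕ) (l : List (List Literal))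
    (hl : ∀ C ∈ l, C.length ≤ 3) :
    ((clauseGadgets B l).flatMap keys).count k ≤
        2 * ((clauseEntries B l).map Prod.snd).count k ∧
      ((clauseEntries B l).map Prod.snd).count k ≤ ((clauseGadgets B l).flatMap keys).count k := by
  induction l generalizing B with
  | nil => simp [clauseEntries, clauseGadgets]
  | cons C l ih =>
    have h1 := ih (B + clauseSize C.length) fun C hC => hl C (List.mem_cons_of_mem _ hC)
    have hC := hl C List.mem_cons_self
    rw [keys_clauseGadgets_cons _ _ _ hC, map_snd_clauseEntries_cons, List.count_append,
      List.count_append, clauseKeys_eq _ hC, List.count_append]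
    split_ifs
    · rw [List.count_nil]
      omega
    · omega

/-- The keys of the vertices are the keys of the occurrences. -/
theorem mem_keys_formulaGadget_iff (k : ℕ) (l : List (List Literal)) (hl : ∀ C ∈ l, C.length ≤ 3) :
    k ∈ (formulaGadget l).keys ↔ k ∈ (clauseEntries 0 l).map Prod.snd := by
  have h := count_keys_clauseGadgets_le k 0 l hl
  have h' : k ∈ (clauseGadgets 0 l).flatMap keys ↔ k ∈ (clauseEntries 0 l).map Prod.snd := by
    rw [← List.count_pos_iff, ← List.count_pos_iff]
    omega
  rw [keys_formulaGadget, List.mem_append, h']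
  refine ⟨fun hk => hk.elim id fun hk => ?_, Or.inl⟩
  obtain ⟨p, hp, hk⟩ := List.mem_flatMap.1 hk
  have := mem_of_mem_equivPairs hp
  rw [List.map_reverse, List.mem_reverse, List.mem_reverse] at this
  rcases (by simpa using hk : k = p.1 ∨ k = p.2) with rfl | rfl
  exacts [this.1, this.2]

theorem count_keys_formulaGadget_le (k : ℕ) (l : List (List Literal))
    (hl : ∀ C ∈ l, C.length ≤ 3) : (formulaGadget l).keys.count k ≤ 4 := by
  have h1 := (count_keys_clauseGadgets_le k 0 l hl).1
  have h2 := count_equivPairs_le k (clauseEntries 0 l).reverse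
  have h3 := List.nodup_iff_count_le_one.1 (nodup_clauseEntries 0 l hl).1 k
  rw [List.map_reverse, List.count_reverse] at h2
  rw [keys_formulaGadget, List.count_append, formulaPairs]
  omega

/-- A list of keys in which each key is the position of its first occurrence. -/
def StandardKeys (ks : List ℕ) : Prop := ∀ i k : ℕ, ks[i]? = some k → k ≤ i ∧ ks[k]? = some k

theorem StandardKeys.append {ks l : List ℕ} (h : StandardKeys ks)
    (hl : ∀ j k, l[j]? = some k → (k ∈ ks) ∨
      (ks.length ≤ k ∧ k ≤ ks.length + j ∧ l[k - ks.length]? = some k)) :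
    StandardKeys (ks ++ l) := by
  have hlt : ∀ k, ks[k]? = some k → k < ks.length := fun k hk => by
    by_contra hn
    rw [List.getElem?_eq_none (by omega)] at hk
    cases hk
  intro i k hi
  rcases lt_or_ge i ks.length with hlen | hlen
  · rw [List.getElem?_append_left hlen] at hi
    obtain ⟨h1, h2⟩ := h i k hi
    exact ⟨h1, by rw [List.getElem?_append_left (hlt k h2), h2]⟩
  · rw [List.getElem?_append_right hlen] at hi
    rcases hl _ _ hi with hk | ⟨h1, h2, h3⟩
    · obtain ⟨j, hj⟩ := List.mem_iff_getElem?.1 hk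
      obtain ⟨h1, h2⟩ := h j k hj
      have := hlt k h2
      exact ⟨by omega, by rw [List.getElem?_append_left this, h2]⟩
    · exact ⟨by omega, by rw [List.getElem?_append_right h1, h3]⟩

theorem standardKeys_clauseGadgets (ks : List ℕ) (h : StandardKeys ks) (l : List (List Literal))
    (hl : ∀ C ∈ l, C.length ≤ 3) :
    StandardKeys (ks ++ (clauseGadgets ks.length l).flatMap keys) := by
  induction l generalizing ks with
  | nil => simpa [clauseGadgets] using h
  | cons C l ih =>
    have hC := hl C List.mem_cons_self
    rw [keys_clauseGadgets_cons _ _ _ hC, ← List.append_assoc]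
    have := ih (ks ++ clauseKeys ks.length C.length) ?_ fun C hC => hl C (List.mem_cons_of_mem _ hC)
    · rwa [List.length_append, length_clauseKeys] at this
    refine h.append fun j k hj => Or.inr ?_
    generalize C.length = n at *
    generalize ks.length = B at *
    have hj' : j < clauseSize n := by
      rw [← length_clauseKeys B]
      by_contra hn
      rw [List.getElem?_eq_none (by omega)] at hj
      cases hj
    interval_cases n <;> simp only [clauseSize] at hj' <;> interval_cases j <;>
      simp [clauseKeys] at hj <;> subst hj <;> simp [clauseKeys]

theorem standard_formulaGadget (l : List (List Literal)) (hl : ∀ C ∈ l, C.length ≤ 3) :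
    (formulaGadget l).Standard := by
  have h1 : StandardKeys ((clauseGadgets 0 l).flatMap keys) :=
    standardKeys_clauseGadgets [] (by intro i k h; simp at h) l hl
  have h2 : StandardKeys (formulaGadget l).keys := by
    rw [keys_formulaGadget]
    refine h1.append fun j k hj => Or.inl ?_
    obtain ⟨p, hp, hk⟩ := List.mem_flatMap.1 (List.mem_of_getElem? hj)
    have hm := mem_of_mem_equivPairs hp
    rw [List.map_reverse, List.mem_reverse, List.mem_reverse] at hm
    have h' : ∀ k ∈ (clauseEntries 0 l).map Prod.snd, k ∈ (clauseGadgets 0 l).flatMap keys := by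
      intro k hk
      have := (count_keys_clauseGadgets_le k 0 l hl).2
      have := List.count_pos_iff.2 hk
      exact List.count_pos_iff.1 (by omega)
    rcases (by simpa using hk : k = p.1 ∨ k = p.2) with rfl | rfl
    exacts [h' _ hm.1, h' _ hm.2]
  intro v
  have hv : (formulaGadget l).keys[(v : ℕ)]? = some ((formulaGadget l).key v) := by
    simp [keys]
  obtain ⟨h3, h4⟩ := h2 _ _ hv
  refine ⟨h3, ?_⟩
  obtain ⟨h5, h6⟩ := List.getElem?_eq_some_iff.1 h4
  rw [length_keys] at h5
  exact ⟨⟨_, h5⟩, rfl, by simpa [keys] using h6⟩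

end Gadget

/-! ### The transformation and its solutions -/

/-- The circuit with a single vertex and a single edge. It has one routing, which has one cycle. -/
def loopCircuit : PolarisedCircuit (Fin 1) (Fin 1) where
  src e := e
  tgt e := e
  valency _ := 1
  outLabel := fiberEquiv (Equiv.prodUnique (Fin 1) (Fin 1)).symm
  inLabel := fiberEquiv (Equiv.prodUnique (Fin 1) (Fin 1)).symm
  pol := ⊥
  valency_eq _ := rfl

/-- The instance for the formula without clauses, with exactly one solution. -/
def loopInstance : RoutingInstance := ⟨1, 1, loopCircuit, 1, one_pos⟩

theorem encode_loopInstance : loopInstance.encode = encodeNats [1, 0, 0, 0, 0, 0, 1] := by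
  have h : loopInstance.classRep = fun _ => 0 := by
    funext v
    refine Nat.le_zero.1 (Nat.sInf_le ⟨v, loopInstance.circuit.pol.refl v, ?_⟩)
    exact Nat.lt_one_iff.1 v.2
  unfold RoutingInstance.encode
  rw [h]
  simp [loopInstance, RoutingInstance.edgeData, loopCircuit]

theorem widthLE_of_numV_le (I : RoutingInstance) (w : ℕ) (h : I.numV ≤ w) : I.circuit.WidthLE w :=
  fun u => (Nat.card_le_card_of_injective _ Subtype.val_injective).trans (by simpa using h)

theorem card_solution_loopInstance :
    Nat.card {ρ : loopInstance.RespectingRouting //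
      loopInstance.target ≤ loopInstance.circuit.numCycles ρ.1} = 1 := by
  have h1 : Subsingleton loopInstance.circuit.Routing :=
    inferInstanceAs (Subsingleton (∀ _ : Fin 1, Equiv.Perm (Fin 1)))
  have h2 : ∀ ρ : loopInstance.circuit.Routing, 1 ≤ loopInstance.circuit.numCycles ρ := by
    intro ρ
    have : Nonempty (Quotient (Equiv.Perm.SameCycle.setoid (loopInstance.circuit.next ρ))) :=
      ⟨Quotient.mk _ (0 : Fin 1)⟩
    have : Finite (Quotient (Equiv.Perm.SameCycle.setoid (loopInstance.circuit.next ρ))) :=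
      Finite.of_surjective (α := Fin 1) (Quotient.mk _) Quotient.mk_surjective
    exact Nat.card_pos
  rw [Nat.card_eq_one_iff_unique]
  refine ⟨⟨fun x y => Subtype.ext (Subtype.ext (Subsingleton.elim _ _))⟩,
    ⟨⟨⟨fun _ => (Equiv.refl _), ?_⟩, h2 _⟩⟩⟩
  intro u v h
  exact Subsingleton.elim (α := Equiv.Perm (Fin 1)) _ _

theorem addRight_injective : Function.Injective (Equiv.addRight : Fin 2 → Equiv.Perm (Fin 2)) :=
  fun a b h => by simpa using Equiv.congr_fun h 0

namespace ThreeCNF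

theorem formulaTarget_pos {l : List (List Literal)} (h : l ≠ []) : 0 < Gadget.formulaTarget l := by
  obtain ⟨C, l, rfl⟩ := List.exists_cons_of_ne_nil h
  have : ∀ n, 0 < Gadget.clauseWeight n := fun n => by
    rcases n with _ | _ | _ | n <;> simp [Gadget.clauseWeight]
  have := this C.length
  simp only [Gadget.formulaTarget, List.map_cons, List.sum_cons]
  omega

/-- The instance of maximal routing for a formula. -/
noncomputable def toRouting (Φ : ThreeCNF) :
    {I : RoutingInstance // I.circuit.WidthLE 6 ∧ I.circuit.ValencyLE 2} :=
  if h : Φ.clauses = [] then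
    ⟨loopInstance, widthLE_of_numV_le _ _ (by simp [loopInstance]), fun _ => one_le_two⟩
  else
    ⟨(Gadget.formulaGadget Φ.clauses).toInstance (Gadget.formulaTarget Φ.clauses)
        (formulaTarget_pos h),
      Gadget.widthLE_circuit _ _ fun k =>
        (Gadget.count_keys_formulaGadget_le k _ Φ.length_le).trans (by norm_num),
      fun _ => le_rfl⟩

variable (Φ : ThreeCNF)

theorem mem_vars_iff (x : ℕ) :
    x ∈ Φ.vars ↔ ∃ r, (x, r) ∈ Gadget.clauseEntries 0 Φ.clauses := by
  rw [vars, occurrences, List.mem_toFinset, ← Gadget.map_fst_clauseEntries 0]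
  simp

open Classical in
/-- The swaps that represent a truth assignment: the classes of the occurrences of the variables
that are true. -/
noncomputable def assignmentBits (α : Φ.Assignment) (k : ℕ) : Fin 2 :=
  if ∃ x : {x // x ∈ Φ.vars}, (x.1, k) ∈ Gadget.clauseEntries 0 Φ.clauses ∧ α x = true then 1 else 0

theorem assignmentBits_of_mem (α : Φ.Assignment) {x k : ℕ} (hx : x ∈ Φ.vars)
    (h : (x, k) ∈ Gadget.clauseEntries 0 Φ.clauses) :
    Φ.assignmentBits α k = Gadget.toBit (α ⟨x, hx⟩) := by
  have key : (∃ y : {y // y ∈ Φ.vars}, (y.1, k) ∈ Gadget.clauseEntries 0 Φ.clauses ∧ α y = true) ↔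
      α ⟨x, hx⟩ = true := by
    refine ⟨?_, fun h' => ⟨⟨x, hx⟩, h, h'⟩⟩
    rintro ⟨⟨y, hy⟩, hm, hα⟩
    have := List.inj_on_of_nodup_map (Gadget.nodup_clauseEntries 0 _ Φ.length_le).1 h hm rfl
    obtain rfl : x = y := congrArg Prod.fst this
    exact hα
  rw [assignmentBits, Gadget.toBit]
  simp only [key]

theorem satisfies_iff (α : Φ.Assignment) (β : ℕ → Fin 2)
    (h : ∀ x (hx : x ∈ Φ.vars), β x = Gadget.toBit (α ⟨x, hx⟩)) :
    Φ.Satisfies α ↔ ∀ C ∈ Φ.clauses, ∃ x ∈ C, β x.var = Gadget.toBit x.positive := by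
  refine forall₂_congr fun C hC => exists_congr fun x => and_congr_right fun hx => ?_
  have hv : x.var ∈ Φ.vars := by
    rw [vars, occurrences, List.mem_toFinset]
    exact List.mem_map_of_mem (List.mem_flatten.2 ⟨C, hC, hx⟩)
  have hb : ∀ p q, Gadget.toBit p = Gadget.toBit q ↔ p = q := by decide
  rw [h _ hv, hb]
  exact ⟨fun ⟨_, h⟩ => h, fun h => ⟨hv, h⟩⟩

/-- The routing that represents a truth assignment. -/
noncomputable def routingOf (α : Φ.Assignment) :
    {ρ : (Gadget.formulaGadget Φ.clauses).circuit.Routing //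
      (Gadget.formulaGadget Φ.clauses).circuit.Respects ρ} :=
  ⟨(Gadget.formulaGadget Φ.clauses).routing (Φ.assignmentBits α), Gadget.respects_routing _ _⟩

theorem exists_key_eq {x k : ℕ} (h : (x, k) ∈ Gadget.clauseEntries 0 Φ.clauses) :
    ∃ v, (Gadget.formulaGadget Φ.clauses).key v = k := by
  have := (Gadget.mem_keys_formulaGadget_iff k _ Φ.length_le).2
    (List.mem_map_of_mem (f := Prod.snd) h)
  simpa [Gadget.keys] using this

theorem routingOf_injective : Function.Injective Φ.routingOf := by
  intro α α' h
  funext ⟨x, hx⟩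
  obtain ⟨k, hk⟩ := (Φ.mem_vars_iff x).1 hx
  obtain ⟨v, hv⟩ := Φ.exists_key_eq hk
  have h1 : (Equiv.addRight (Φ.assignmentBits α ((Gadget.formulaGadget Φ.clauses).key v)) :
      Equiv.Perm (Fin 2)) = Equiv.addRight (Φ.assignmentBits α' _) :=
    congrFun (congrArg Subtype.val h) v
  have h2 := addRight_injective h1
  rw [hv, Φ.assignmentBits_of_mem α hx hk, Φ.assignmentBits_of_mem α' hx hk] at h2
  have hb : ∀ p q, Gadget.toBit p = Gadget.toBit q → p = q := by decide
  exact hb _ _ h2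

theorem numCycles_le (ρ : (Gadget.formulaGadget Φ.clauses).circuit.Routing)
    (hρ : (Gadget.formulaGadget Φ.clauses).circuit.Respects ρ) :
    (Gadget.formulaGadget Φ.clauses).circuit.numCycles ρ ≤ Gadget.formulaTarget Φ.clauses := by
  obtain ⟨b, rfl⟩ := Gadget.exists_eq_routing _ ρ hρ
  rw [Gadget.numCycles_routing]
  exact (Gadget.cycles_formulaGadget_le _ Φ.length_le b).1

theorem numCycles_eq_iff (ρ) :
    (Gadget.formulaGadget Φ.clauses).circuit.numCycles ρ.1 = Gadget.formulaTarget Φ.clauses ↔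
      ∃ α, Φ.Satisfies α ∧ Φ.routingOf α = ρ := by
  obtain ⟨ρ, hρ⟩ := ρ
  obtain ⟨b, rfl⟩ := Gadget.exists_eq_routing _ ρ hρ
  rw [Gadget.numCycles_routing, (Gadget.cycles_formulaGadget_le _ Φ.length_le b).2]
  constructor
  · rintro ⟨β, hb, hs⟩
    have hβ : ∀ a : Fin 2, a = Gadget.toBit (decide (a = 1)) := by decide
    refine ⟨fun x => decide (β x = 1), (Φ.satisfies_iff _ β fun x _ => hβ _).2 hs,
      Subtype.ext ?_⟩
    have key : ∀ v, Φ.assignmentBits (fun x => decide (β x = 1))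
        ((Gadget.formulaGadget Φ.clauses).key v) =
        b ((Gadget.formulaGadget Φ.clauses).key v) := by
      intro v
      have hv : (Gadget.formulaGadget Φ.clauses).key v ∈
          (Gadget.formulaGadget Φ.clauses).keys := by simp [Gadget.keys]
      obtain ⟨⟨x, k⟩, hm, hk⟩ :=
        List.mem_map.1 ((Gadget.mem_keys_formulaGadget_iff _ _ Φ.length_le).1 hv)
      obtain rfl : k = _ := hk
      rw [Φ.assignmentBits_of_mem _ ((Φ.mem_vars_iff x).2 ⟨_, hm⟩) hm, ← hβ]
      exact (hb _ hm).symm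
    funext v
    exact congrArg (fun a => (Equiv.addRight a : Equiv.Perm (Fin 2))) (key v)
  · rintro ⟨α, hs, h⟩
    have hbits : ∀ e ∈ Gadget.clauseEntries 0 Φ.clauses, Φ.assignmentBits α e.2 = b e.2 := by
      rintro ⟨x, k⟩ he
      obtain ⟨v, hv⟩ := Φ.exists_key_eq he
      have h1 : (Equiv.addRight (Φ.assignmentBits α ((Gadget.formulaGadget Φ.clauses).key v)) :
          Equiv.Perm (Fin 2)) = Equiv.addRight (b _) := congrFun (congrArg Subtype.val h) v
      have h2 := addRight_injective h1
      rwa [hv] at h2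
    obtain ⟨β, hβ⟩ : ∃ β : ℕ → Fin 2, ∀ x (hx : x ∈ Φ.vars), β x = Gadget.toBit (α ⟨x, hx⟩) :=
      ⟨fun x => if hx : x ∈ Φ.vars then Gadget.toBit (α ⟨x, hx⟩) else 0, fun x hx => dif_pos hx⟩
    refine ⟨β, ?_, (Φ.satisfies_iff α _ hβ).1 hs⟩
    rintro ⟨x, k⟩ he
    have hx := (Φ.mem_vars_iff x).2 ⟨k, he⟩
    rw [← hbits _ he, Φ.assignmentBits_of_mem α hx he]
    exact (hβ x hx).symm

theorem formulaTarget_eq (h : ∀ C ∈ Φ.clauses, C ≠ []) :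
    Gadget.formulaTarget Φ.clauses = Φ.cycleThreshold := by
  have h1 : (Gadget.formulaPairs Φ.clauses).length = Φ.numEquivalences := by
    rw [Gadget.formulaPairs, length_equivPairs, List.map_reverse, List.toFinset_reverse,
      Gadget.map_fst_clauseEntries, numEquivalences]
    refine Finset.sum_congr rfl fun x _ => ?_
    rw [List.count_reverse]
    rfl
  have h2 : ∀ l : List (List Literal), (∀ C ∈ l, C ≠ []) → (∀ C ∈ l, C.length ≤ 3) →
      (l.map fun C => Gadget.clauseWeight C.length).sum =
        3 * (l.countP fun C => C.length = 3) + 4 * (l.countP fun C => C.length = 2) +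
          2 * (l.countP fun C => C.length = 1) := by
    intro l
    induction l with
    | nil => simp
    | cons C l ih =>
      intro h h'
      have ih := ih (fun C hC => h C (List.mem_cons_of_mem _ hC))
        fun C hC => h' C (List.mem_cons_of_mem _ hC)
      have hC := List.length_pos_iff.2 (h C List.mem_cons_self)
      have hC' := h' C List.mem_cons_self
      simp only [List.map_cons, List.sum_cons, List.countP_cons, ih]
      generalize C.length = n at *
      interval_cases n <;> simp [Gadget.clauseWeight] <;> ring
  rw [Gadget.formulaTarget, h1, h2 _ h Φ.length_le]
  rfl

theorem card_solution_toRouting :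
    Nat.card (threeSAT.Solution Φ) = Nat.card ((maximalRouting 6 2).Solution Φ.toRouting) := by
  by_cases h : Φ.clauses = []
  · have h1 : Nat.card (threeSAT.Solution Φ) = 1 := by
      have hv : IsEmpty {x // x ∈ Φ.vars} := ⟨fun ⟨x, hx⟩ => by
        simp [vars, occurrences, h] at hx⟩
      rw [Nat.card_eq_one_iff_unique]
      refine ⟨⟨fun x y => Subtype.ext (Subsingleton.elim (α := Φ.Assignment) _ _)⟩,
        ⟨⟨fun _ => true, ?_⟩⟩⟩
      intro C hC
      simp [h] at hC
    rw [h1, ← card_solution_loopInstance]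
    have h2 : Φ.toRouting = _ := dif_pos h
    rw [h2]
    rfl
  · have h2 : Φ.toRouting = _ := dif_neg h
    rw [h2]
    refine Nat.card_congr (Equiv.ofBijective (fun α => ⟨Φ.routingOf α.1, ?_⟩) ⟨?_, ?_⟩)
    · exact ((Φ.numCycles_eq_iff _).2 ⟨α.1, α.2, rfl⟩).ge
    · intro α α' h
      exact Subtype.ext (Φ.routingOf_injective (congrArg Subtype.val h))
    · rintro ⟨ρ, hρ⟩
      obtain ⟨α, hα, hr⟩ := (Φ.numCycles_eq_iff ρ).1 (le_antisymm (Φ.numCycles_le _ ρ.2) hρ)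
      exact ⟨⟨α, hα⟩, Subtype.ext hr⟩

end ThreeCNF

/-! ### Structured programs on a fixed set of stacks -/

/-- The stacks of the machine that computes the transformation. -/
inductive Reg
  | input | output | keys | edges | size | target | entries | rest | word | first | second | cand
  | diff | counter | carry | temp
  deriving DecidableEq

instance : Fintype Reg :=
  ⟨{.input, .output, .keys, .edges, .size, .target, .entries, .rest, .word, .first, .second, .cand,
    .diff, .counter, .carry, .temp}, fun k => by cases k <;> decide⟩

/-- The contents of the stacks. -/
@[ext]
structure Mem where
  /-- the formula -/
  input : List Γ' := []
  /-- the instance of maximal routing -/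
  output : List Γ' := []
  /-- the keys of the vertices so far, written backwards -/
  keys : List Γ' := []
  /-- the edges so far, written backwards -/
  edges : List Γ' := []
  /-- the number of vertices so far, in unary -/
  size : List Γ' := []
  /-- the number of cycles asked for so far, in unary -/
  target : List Γ' := []
  /-- the entries `(variable, key)` of the occurrences that still have to be identified -/
  entries : List Γ' := []
  /-- the entries of the variables other than the present one -/
  rest : List Γ' := []
  /-- the present variable -/
  word : List Γ' := []
  /-- the key of the last occurrence of the present variable, in unary -/
  first : List Γ' := []
  /-- the key of the entry under consideration, in unary -/
  second : List Γ' := []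
  /-- the variable of the entry under consideration -/
  cand : List Γ' := []
  /-- nonempty if `word` and `cand` differ -/
  diff : List Γ' := []
  /-- a binary counter -/
  counter : List Γ' := []
  /-- the carries in an increment of the counter -/
  carry : List Γ' := []
  /-- auxiliary stack -/
  temp : List Γ' := []

namespace Mem

/-- The contents of a stack. -/
def get (m : Mem) : Reg → List Γ'
  | .input => m.input
  | .output => m.output
  | .keys => m.keys
  | .edges => m.edges
  | .size => m.size
  | .target => m.target
  | .entries => m.entries
  | .rest => m.rest
  | .word => m.word
  | .first => m.first
  | .second => m.second
  | .cand => m.cand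
  | .diff => m.diff
  | .counter => m.counter
  | .carry => m.carry
  | .temp => m.temp

/-- Replaces the contents of a stack. -/
def set (m : Mem) (k : Reg) (l : List Γ') : Mem :=
  match k with
  | .input => { m with input := l }
  | .output => { m with output := l }
  | .keys => { m with keys := l }
  | .edges => { m with edges := l }
  | .size => { m with size := l }
  | .target => { m with target := l }
  | .entries => { m with entries := l }
  | .rest => { m with rest := l }
  | .word => { m with word := l }
  | .first => { m with first := l }
  | .second => { m with second := l }
  | .cand => { m with cand := l }
  | .diff => { m with diff := l }
  | .counter => { m with counter := l }
  | .carry => { m with carry := l }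
  | .temp => { m with temp := l }

@[simp] theorem get_set_self (m : Mem) (k : Reg) (l : List Γ') : (m.set k l).get k = l := by
  cases k <;> rfl

theorem get_set_of_ne (m : Mem) {k j : Reg} (h : j ≠ k) (l : List Γ') :
    (m.set k l).get j = m.get j := by
  cases k <;> cases j <;> first | rfl | exact absurd rfl h

theorem get_set (m : Mem) (k : Reg) (l : List Γ') :
    (m.set k l).get = Function.update m.get k l := by
  funext j
  by_cases h : j = k
  · subst h; simp
  · rw [get_set_of_ne m h, Function.update_of_ne h]

theorem ext_get {m m' : Mem} (h : ∀ k, m.get k = m'.get k) : m = m' :=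
  Mem.ext (h .input) (h .output) (h .keys) (h .edges) (h .size) (h .target) (h .entries) (h .rest)
    (h .word) (h .first) (h .second) (h .cand) (h .diff) (h .counter) (h .carry) (h .temp)

@[simp] theorem set_get (m : Mem) (k : Reg) : m.set k (m.get k) = m := by
  cases k <;> rfl

@[simp] theorem set_set (m : Mem) (k : Reg) (l l' : List Γ') :
    (m.set k l).set k l' = m.set k l' := by
  cases k <;> rfl

end Mem

/-- Structured programs. -/
inductive Prog
  /-- does nothing -/
  | skip
  /-- pushes a symbol -/
  | push (k : Reg) (a : Γ')
  /-- one program after the other -/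
  | seq (p q : Prog)
  /-- pops a stack, with result `none` if it is empty, and runs a program that depends on the
  result; then starts again if the result satisfies the condition -/
  | popWhile (k : Reg) (c : Option Γ' → Bool) (f : Option Γ' → Prog)

namespace Prog

/-- `Run p m m' t`: the program `p`, started with the stacks `m`, ends with the stacks `m'` in at
most `t` steps. -/
inductive Run : Prog → Mem → Mem → ℕ → Prop
  | skip (m) : Run skip m m 1
  | push (k a m) : Run (push k a) m (m.set k (a :: m.get k)) 1
  | seq {p q m₁ m₂ m₃ t t'} : Run p m₁ m₂ t → Run q m₂ m₃ t' → Run (seq p q) m₁ m₃ (t + t')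
  | popStop {k c f m m' t} : c (m.get k).head? = false →
      Run (f (m.get k).head?) (m.set k (m.get k).tail) m' t → Run (popWhile k c f) m m' (t + 1)
  | popStep {k c f m m' m'' t t'} : c (m.get k).head? = true →
      Run (f (m.get k).head?) (m.set k (m.get k).tail) m' t → Run (popWhile k c f) m' m'' t' →
      Run (popWhile k c f) m m'' (t + t' + 1)
  | mono {p m m' t t'} : Run p m m' t → t ≤ t' → Run p m m' t'

theorem Run.congr {p : Prog} {m m' m'' : Mem} {t t' : ℕ} (h : Run p m m' t) (hm : m' = m'')
    (ht : t ≤ t') : Run p m m'' t' := hm ▸ h.mono ht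

/-- A stack grows by at most one symbol in each step. -/
theorem Run.length_le {p : Prog} {m m' : Mem} {t : ℕ} (h : Run p m m' t) (j : Reg) :
    (m'.get j).length ≤ (m.get j).length + t := by
  have hset : ∀ (m : Mem) (k : Reg), ((m.set k (m.get k).tail).get j).length ≤
      (m.get j).length := by
    intro m k
    by_cases hj : j = k
    · subst hj; simp
    · rw [Mem.get_set_of_ne m hj]
  induction h with
  | skip => omega
  | push k a m =>
    by_cases hj : j = k
    · subst hj; simp
    · rw [Mem.get_set_of_ne m hj]; omega
  | seq _ _ h1 h2 => omega
  | @popStop k c f m _ _ _ _ ih => have := hset m k; omega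
  | @popStep k c f m _ _ _ _ _ _ _ ih ih' => have := hset m k; omega
  | mono _ _ ih => omega

/-! ### Compilation to multi-stack Turing machines -/

/-- The labels of the machine for a program. -/
def Label : Prog → Type
  | skip => Unit
  | push _ _ => Unit
  | seq p q => p.Label ⊕ q.Label
  | popWhile _ _ f => Option (Σ o, (f o).Label)

instance fintypeLabel : (p : Prog) → Fintype p.Label
  | skip => inferInstanceAs (Fintype Unit)
  | push _ _ => inferInstanceAs (Fintype Unit)
  | seq p q =>
    letI := fintypeLabel p
    letI := fintypeLabel q
    inferInstanceAs (Fintype (p.Label ⊕ q.Label))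
  | popWhile _ _ f =>
    letI := fun o => fintypeLabel (f o)
    inferInstanceAs (Fintype (Option (Σ o, (f o).Label)))

/-- The label at which the machine for a program starts. -/
def entry : (p : Prog) → p.Label
  | skip => ()
  | push _ _ => ()
  | seq p _ => Sum.inl p.entry
  | popWhile _ _ _ => none

/-- The statements of the machine for a program, as part of a machine with labels `Λ`; at the end
it jumps to the label `out`. The internal state is the result of the last `pop`. -/
def compile {Λ : Type} : (p : Prog) → (p.Label → Λ) → Λ → p.Label →
    Turing.TM2.Stmt (fun _ : Reg => Γ') Λ (Option Γ')
  | skip, _, out, _ => .goto fun _ => out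
  | push k a, _, out, _ => .push k (fun _ => a) (.goto fun _ => out)
  | seq p q, emb, out, l =>
    match l with
    | Sum.inl l => compile p (fun l => emb (Sum.inl l)) (emb (Sum.inr q.entry)) l
    | Sum.inr l => compile q (fun l => emb (Sum.inr l)) out l
  | popWhile k c f, emb, out, l =>
    match l with
    | none => .pop k (fun _ o => o) (.goto fun o => emb (some ⟨o, (f o).entry⟩))
    | some ⟨o, l⟩ =>
      compile (f o) (fun l => emb (some ⟨o, l⟩)) (if c o then emb none else out) l

theorem Run.reaches {p : Prog} {m m' : Mem} {t : ℕ} (h : Run p m m' t) {Λ : Type}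
    (M : Λ → Turing.TM2.Stmt (fun _ : Reg => Γ') Λ (Option Γ')) (emb : p.Label → Λ) (out : Λ)
    (hM : ∀ l, M (emb l) = compile p emb out l) (v : Option Γ') :
    ∃ n ≤ t, ∃ v', (flip bind (Turing.TM2.step M))^[n]
      (some (⟨some (emb p.entry), v, m.get⟩ : Turing.TM2.Cfg _ _ _)) =
        some ⟨some out, v', m'.get⟩ := by
  induction h generalizing out v with
  | skip m =>
    refine ⟨1, le_rfl, v, ?_⟩
    simp only [Function.iterate_one, flip, Option.bind_eq_bind, Option.bind_some, Turing.TM2.step,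
      hM]
    rfl
  | push k a m =>
    refine ⟨1, le_rfl, v, ?_⟩
    simp only [Function.iterate_one, flip, Option.bind_eq_bind, Option.bind_some, Turing.TM2.step,
      hM, Mem.get_set]
    rfl
  | @seq p q m₁ m₂ m₃ t t' _ _ ih₁ ih₂ =>
    obtain ⟨n, hn, v₁, h₁⟩ := ih₁ (fun l => emb (Sum.inl l)) (emb (Sum.inr q.entry))
      (fun l => hM (Sum.inl l)) v
    obtain ⟨n', hn', v₂, h₂⟩ := ih₂ (fun l => emb (Sum.inr l)) out (fun l => hM (Sum.inr l)) v₁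
    refine ⟨n' + n, by omega, v₂, ?_⟩
    rw [Function.iterate_add_apply]
    exact (congrArg _ h₁).trans h₂
  | @popStop k c f m m' t hc _ ih =>
    obtain ⟨n, hn, v₁, h₁⟩ := ih (fun l => emb (some ⟨_, l⟩)) out
      (fun l => (hM (some ⟨_, l⟩)).trans (by simp only [compile, hc]; rfl)) (m.get k).head?
    refine ⟨n + 1, by omega, v₁, ?_⟩
    rw [Function.iterate_add_apply, Function.iterate_one]
    refine Eq.trans (congrArg _ ?_) h₁
    simp only [flip, Option.bind_eq_bind, Option.bind_some, Turing.TM2.step, hM, Mem.get_set]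
    rfl
  | @popStep k c f m m' m'' t t' hc _ _ ih ih' =>
    obtain ⟨n, hn, v₁, h₁⟩ := ih (fun l => emb (some ⟨_, l⟩)) (emb none)
      (fun l => (hM (some ⟨_, l⟩)).trans (by simp only [compile, hc]; rfl)) (m.get k).head?
    obtain ⟨n', hn', v₂, h₂⟩ := ih' emb out hM v₁
    refine ⟨n' + (n + 1), by omega, v₂, ?_⟩
    rw [Function.iterate_add_apply, Function.iterate_add_apply, Function.iterate_one]
    refine Eq.trans (congrArg _ (Eq.trans (congrArg _ ?_) h₁)) h₂
    simp only [flip, Option.bind_eq_bind, Option.bind_some, Turing.TM2.step, hM, Mem.get_set]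
    rfl
  | mono _ hle ih =>
    obtain ⟨n, hn, h⟩ := ih emb out hM v
    exact ⟨n, hn.trans hle, h⟩

/-- The machine for a program: it runs the program, clears the internal state, and halts. -/
def machine (p : Prog) : Turing.FinTM2 where
  K := Reg
  k₀ := .input
  k₁ := .output
  Γ _ := Γ'
  Λ := Option p.Label
  main := some p.entry
  σ := Option Γ'
  initialState := none
  Γk₀Fin := inferInstanceAs (Fintype Γ')
  m
    | none => .load (fun _ => none) .halt
    | some l => compile p some none l

/-- A function is computable in polynomial time if a program computes it in polynomial time. -/
theorem computableInPolyTime_of_run {α β : Type} {ea : α → List Γ'} {eb : β → List Γ'} {f : α → β}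
    (p : Prog) (time : Polynomial ℕ)
    (h : ∀ a, Run p { input := ea a } { output := eb (f a) } (time.eval (ea a).length)) :
    Nonempty (Turing.TM2ComputableInPolyTime ea eb f) := by
  refine ⟨⟨⟨p.machine, Equiv.refl Γ', Equiv.refl Γ'⟩, time + 1, fun a => Classical.choice ?_⟩⟩
  obtain ⟨n, hn, v, hr⟩ := (h a).reaches p.machine.m some none (fun _ => rfl) none
  refine ⟨⟨⟨n + 1, ?_⟩, by simpa using hn⟩⟩
  have h1 : Turing.initList p.machine (List.map (Equiv.refl Γ').invFun (ea a)) =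
      ⟨some (some p.entry), none, Mem.get { input := ea a }⟩ := by
    refine (congrArg (Turing.initList p.machine) (List.map_id (ea a))).trans ?_
    refine congrArg (Turing.TM2.Cfg.mk _ _) ?_
    funext k
    cases k <;> rfl
  have h2 : Turing.haltList p.machine (List.map (Equiv.refl Γ').invFun (eb (f a))) =
      ⟨none, none, Mem.get { output := eb (f a) }⟩ := by
    refine (congrArg (Turing.haltList p.machine) (List.map_id (eb (f a)))).trans ?_
    refine congrArg (Turing.TM2.Cfg.mk _ _) ?_
    funext k
    cases k <;> rfl
  rw [Option.map_some, h1, h2, add_comm, Function.iterate_add_apply]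
  exact congrArg _ hr

end Prog

/-! ### Basic programs -/

namespace Prog

/-- Pops a stack and branches on the result. -/
def case (k : Reg) (f : Option Γ' → Prog) : Prog := popWhile k (fun _ => false) f

/-- Pops a stack until it is empty, and runs a program for each symbol. -/
def loop (k : Reg) (f : Γ' → Prog) : Prog := popWhile k Option.isSome fun o => o.elim skip f

theorem Run.case {k f m m' t} (h : Run (f (m.get k).head?) (m.set k (m.get k).tail) m' t) :
    Run (case k f) m m' (t + 1) := .popStop rfl h

theorem Run.loop_nil {k f m} (h : m.get k = []) : Run (loop k f) m m 2 := by
  refine .popStop (t := 1) (by rw [h]; rfl) ?_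
  rw [h]
  have hm : m.set k [] = m := by rw [← h, Mem.set_get]
  exact (Run.skip _).congr hm le_rfl

theorem Run.loop_cons {k f m m' m'' a l t t'} (h : m.get k = a :: l)
    (h₁ : Run (f a) (m.set k l) m' t) (h₂ : Run (loop k f) m' m'' t') :
    Run (loop k f) m m'' (t + t' + 1) := by
  refine .popStep (by rw [h]; rfl) ?_ h₂
  rw [h]
  exact h₁

/-- Pushes the symbols of a list, from left to right. -/
def pushList (k : Reg) : List Γ' → Prog
  | [] => skip
  | a :: l => seq (push k a) (pushList k l)

theorem run_pushList (k : Reg) (l : List Γ') (m : Mem) :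
    Run (pushList k l) m (m.set k (l.reverse ++ m.get k)) (l.length + 1) := by
  induction l generalizing m with
  | nil => exact (Run.skip m).congr (by simp) (by simp)
  | cons a l ih =>
    exact ((Run.push k a m).seq (ih _)).congr (by simp) (by simp; omega)

/-- Pops a stack `n` times. -/
def popMany (k : Reg) : ℕ → Prog
  | 0 => skip
  | n + 1 => seq (case k fun _ => skip) (popMany k n)

theorem run_popMany (k : Reg) (n : ℕ) (m : Mem) :
    Run (popMany k n) m (m.set k ((m.get k).drop n)) (2 * n + 1) := by
  induction n generalizing m with
  | zero => exact (Run.skip m).congr (by simp) (by simp)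
  | succ n ih =>
    refine ((Run.case (Run.skip _)).seq (ih _)).congr ?_ (by omega)
    rw [Mem.set_set, Mem.get_set_self, List.drop_tail]

/-- Empties a stack. -/
def clear (k : Reg) : Prog := loop k fun _ => skip

theorem run_clear (k : Reg) (m : Mem) :
    Run (clear k) m (m.set k []) (2 * (m.get k).length + 2) := by
  generalize hl : m.get k = l
  induction l generalizing m with
  | nil => exact (Run.loop_nil hl).congr (by rw [← hl, Mem.set_get]) (by simp)
  | cons a l ih =>
    refine (Run.loop_cons hl (Run.skip _) (ih _ (by simp))).congr (by simp) (by simp; omega)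

/-- Moves the contents of one stack to another one, which reverses them. -/
def move (a b : Reg) : Prog := loop a fun x => push b x

theorem run_move {a b : Reg} (h : a ≠ b) (m : Mem) :
    Run (move a b) m ((m.set a []).set b ((m.get a).reverse ++ m.get b))
      (2 * (m.get a).length + 2) := by
  generalize hl : m.get a = l
  induction l generalizing m with
  | nil =>
    refine (Run.loop_nil hl).congr ?_ (by simp)
    rw [← hl, Mem.set_get]
    simp [hl]
  | cons x l ih =>
    refine (Run.loop_cons hl (Run.push _ _ _) (ih _ ?_)).congr ?_ (by simp; omega)
    · rw [Mem.get_set_of_ne _ h, Mem.get_set_self]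
    · refine Mem.ext_get fun k => ?_
      simp only [Mem.get_set, Function.update_apply]
      split_ifs <;> simp_all

/-! ### Writing unary numbers in binary -/

/-- The number of leading `true`s, which are the carries of an increment. -/
def leadingTrue : List Bool → ℕ
  | true :: l => leadingTrue l + 1
  | _ => 0

/-- The part of the incremented number after the carries. -/
def incTail : List Bool → List Bool
  | true :: l => incTail l
  | _ :: l => true :: l
  | [] => [true]

theorem leadingTrue_le (l : List Bool) : leadingTrue l ≤ l.length := by
  induction l with
  | nil => simp [leadingTrue]
  | cons a l ih => cases a <;> simp [leadingTrue, ih]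

theorem bits_succ (n : ℕ) :
    (n + 1).bits = List.replicate (leadingTrue n.bits) false ++ incTail n.bits := by
  induction n using Nat.binaryRec' with
  | zero => simp [leadingTrue, incTail]
  | bit b n h ih =>
    rw [Nat.bits_append_bit n b h]
    cases b
    · have hn : n ≠ 0 := fun h0 => by simpa using h h0
      rw [Nat.bit_false_apply, Nat.bit1_bits]
      rfl
    · have h2 : Nat.bit true n + 1 = 2 * (n + 1) := by rw [Nat.bit_true_apply]; ring
      rw [h2, Nat.bit0_bits _ (by omega), ih]
      rfl

theorem length_bits_le (n : ℕ) : n.bits.length ≤ n := by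
  rw [Nat.size_eq_bits_len, Nat.size_le]
  exact Nat.lt_two_pow_self

/-- Increments the binary counter. -/
def inc : Prog :=
  seq (popWhile .counter (· == some (Γ'.bit true)) fun
      | some (Γ'.bit true) => push .carry Γ'.blank
      | _ => push .counter (Γ'.bit true))
    (loop .carry fun _ => push .counter (Γ'.bit false))

theorem run_inc (n : ℕ) (m : Mem) (hc : m.counter = n.bits.map Γ'.bit) (hk : m.carry = []) :
    Run inc m { m with counter := (n + 1).bits.map Γ'.bit } (4 * n + 4) := by
  have h1 : ∀ (l : List Bool) (c : ℕ) (m : Mem), m.counter = l.map Γ'.bit →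
      m.carry = List.replicate c Γ'.blank →
      Run (popWhile .counter (· == some (Γ'.bit true)) fun
        | some (Γ'.bit true) => push .carry Γ'.blank
        | _ => push .counter (Γ'.bit true)) m
        { m with
          counter := (incTail l).map Γ'.bit
          carry := List.replicate (c + leadingTrue l) Γ'.blank } (2 * l.length + 2) := by
    intro l
    induction l with
    | nil =>
      intro c m hc hk
      obtain ⟨⟩ := m
      subst hc hk
      exact (Run.popStop rfl (Run.push _ _ _)).congr rfl (by omega)
    | cons a l ih =>
      intro c m hc hk
      obtain ⟨⟩ := m
      subst hc hk
      cases a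
      · exact (Run.popStop rfl (Run.push _ _ _)).congr rfl (by omega)
      · refine (Run.popStep rfl (Run.push _ _ _) (ih (c + 1) _ rfl rfl)).congr ?_
          (by simp only [List.length_cons]; omega)
        have h : c + 1 + leadingTrue l = c + (leadingTrue l + 1) := by omega
        simp only [leadingTrue, incTail, Mem.set, h]
  have h2 : ∀ (c : ℕ) (m : Mem), m.carry = List.replicate c Γ'.blank →
      Run (loop .carry fun _ => push .counter (Γ'.bit false)) m
        { m with
          counter := List.replicate c (Γ'.bit false) ++ m.counter
          carry := [] } (2 * c + 2) := by
    intro c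
    induction c with
    | zero =>
      intro m hk
      obtain ⟨⟩ := m
      subst hk
      exact (Run.loop_nil rfl).congr rfl le_rfl
    | succ c ih =>
      intro m hk
      obtain ⟨⟩ := m
      subst hk
      refine (Run.loop_cons (f := fun _ => push .counter (Γ'.bit false)) (k := .carry) rfl
        (Run.push _ _ _) (ih _ rfl)).congr ?_ (by omega)
      simp only [Mem.set, Mem.get, List.replicate_succ', List.append_assoc, List.cons_append,
        List.nil_append]
  refine ((h1 n.bits 0 m hc hk).seq (h2 _ _ rfl)).congr ?_ ?_
  · simp [bits_succ, hk]
  · have := leadingTrue_le n.bits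
    have := length_bits_le n
    omega

/-- Appends the unary number on one stack in binary, with a comma, to the string that is written
backwards on another stack. -/
def emit (src dst : Reg) : Prog :=
  seq (loop src fun _ => seq (push .temp Γ'.blank) inc)
    (seq (move .temp src) (seq (move .counter dst) (push dst Γ'.comma)))

/-- The auxiliary stacks of `emit`. -/
def scratch : Reg → Bool
  | .counter | .carry | .temp => true
  | _ => false

theorem run_emit {src dst : Reg} (hs : scratch src = false) (hd : scratch dst = false)
    (hsd : src ≠ dst) (n : ℕ) (m : Mem) (hn : m.get src = List.replicate n Γ'.blank)
    (h1 : m.counter = []) (h2 : m.carry = []) (h3 : m.temp = []) :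
    Run (emit src dst) m (m.set dst ((encodeBinary n).reverse ++ m.get dst)) (8 * (n + 1) ^ 2) := by
  have hne : ∀ k, scratch k = true → src ≠ k ∧ dst ≠ k := by
    refine fun k hk => ⟨?_, ?_⟩ <;> rintro rfl <;> simp_all
  obtain ⟨hsc, hdc⟩ := hne .counter rfl
  obtain ⟨hsk, hdk⟩ := hne .carry rfl
  obtain ⟨hst, hdt⟩ := hne .temp rfl
  have count : ∀ (n j : ℕ) (m : Mem), m.get src = List.replicate n Γ'.blank →
      m.get .counter = j.bits.map Γ'.bit → m.get .carry = [] →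
      Run (loop src fun _ => seq (push .temp Γ'.blank) inc) m
        (((m.set src []).set .temp (List.replicate n Γ'.blank ++ m.get .temp)).set .counter
          ((j + n).bits.map Γ'.bit)) (n * (4 * (j + n) + 6) + 2) := by
    intro n
    induction n with
    | zero =>
      intro j m hn hc hk
      refine (Run.loop_nil hn).congr ?_ (by simp)
      simp only [List.replicate_zero] at hn
      rw [← hn, Mem.set_get, List.replicate_zero, List.nil_append, Mem.set_get, add_zero, ← hc,
        Mem.set_get]
    | succ n ih =>
      intro j m hn hc hk
      have hb : Run (seq (push .temp Γ'.blank) inc) (m.set src (List.replicate n Γ'.blank))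
          (((m.set src (List.replicate n Γ'.blank)).set .temp (Γ'.blank :: m.get .temp)).set
            .counter ((j + 1).bits.map Γ'.bit)) (4 * j + 5) := by
        refine ((Run.push _ _ _).seq (run_inc j _ ?_ ?_)).congr ?_ (t := 1 + (4 * j + 4)) (by omega)
        · exact (Mem.get_set_of_ne _ hsc.symm _).trans hc
        · exact (Mem.get_set_of_ne _ hsk.symm _).trans hk
        · rw [Mem.get_set_of_ne _ hst.symm]
          rfl
      refine (Run.loop_cons hn hb (ih (j + 1) _ ?_ ?_ ?_)).congr ?_ ?_
      · rw [Mem.get_set_of_ne _ hsc, Mem.get_set_of_ne _ hst, Mem.get_set_self]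
      · rw [Mem.get_set_self]
      · rw [Mem.get_set_of_ne _ (by decide), Mem.get_set_of_ne _ (by decide),
          Mem.get_set_of_ne _ hsk.symm, hk]
      · refine Mem.ext_get fun k => ?_
        simp only [Mem.get_set, Function.update_apply]
        have : j + 1 + n = j + (n + 1) := by ring
        split_ifs <;> simp_all [List.replicate_succ', List.append_assoc]
      · ring_nf
        nlinarith [Nat.zero_le (j * n)]
  refine ((count n 0 m hn (by simp [Mem.get, h1]) h2).seq ((run_move hst.symm _).seq
    ((run_move hdc.symm _).seq (Run.push _ _ _)))).congr ?_ ?_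
  · refine Mem.ext_get fun k => ?_
    simp only [Mem.get_set, Function.update_apply]
    have h1 : m.get .counter = [] := h1
    have h3 : m.get .temp = [] := h3
    split_ifs <;> simp_all [encodeBinary]
  · have := length_bits_le n
    have h3 : m.get .temp = [] := h3
    simp only [Mem.get_set, Function.update_apply]
    simp [hsc.symm, h3]
    nlinarith

end Prog

/-! ### Reading the clauses -/

theorem encodeNats_append (l l' : List ℕ) :
    encodeNats (l ++ l') = encodeNats l ++ encodeNats l' := by
  simp [encodeNats]

theorem encodeNats_cons (a : ℕ) (l : List ℕ) :
    encodeNats (a :: l) = encodeBinary a ++ encodeNats l :=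
  rfl

namespace Gadget

/-- The edges of a gadget; `inl c` stands for the number `B + c`, where the vertices are numbered
from `B`, and `inr c` for the number `c`. -/
def edgeItems (g : Gadget) : List (ℕ ⊕ ℕ) :=
  (List.ofFn fun v : Fin g.size =>
    [Sum.inl (v : ℕ), Sum.inr 0, Sum.inl ((g.wire (v, 0)).1 : ℕ), Sum.inr ((g.wire (v, 0)).2 : ℕ),
      Sum.inl (v : ℕ), Sum.inr 1, Sum.inl ((g.wire (v, 1)).1 : ℕ),
      Sum.inr ((g.wire (v, 1)).2 : ℕ)]).flatten

/-- The number that an item of `edgeItems` stands for. -/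
def itemValue (B : ℕ) : ℕ ⊕ ℕ → ℕ := Sum.elim (B + ·) id

theorem edges_eq_map_itemValue (g : Gadget) (B : ℕ) :
    g.edges B = g.edgeItems.map (itemValue B) := by
  rw [edges, edgeItems, List.map_flatten, List.map_ofFn]
  rfl

theorem length_edgeItems (g : Gadget) : g.edgeItems.length = g.size * 8 := by
  rw [edgeItems, List.length_flatten, List.map_ofFn]
  have : (List.length ∘ fun v : Fin g.size =>
    [Sum.inl (v : ℕ), Sum.inr 0, Sum.inl ((g.wire (v, 0)).1 : ℕ), Sum.inr ((g.wire (v, 0)).2 : ℕ),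
      Sum.inl (v : ℕ), Sum.inr 1, Sum.inl ((g.wire (v, 1)).1 : ℕ),
      Sum.inr ((g.wire (v, 1)).2 : ℕ)]) = fun _ => 8 := rfl
  rw [this, List.ofFn_const, List.sum_replicate, smul_eq_mul]

theorem edgeItems_le (g : Gadget) : ∀ i ∈ g.edgeItems, i.elim id id ≤ g.size := by
  intro i hi
  obtain ⟨l, hl, hi⟩ := List.mem_flatten.1 hi
  obtain ⟨v, rfl⟩ := (List.mem_ofFn' _ _).1 hl
  have h1 := v.2
  have h2 := (g.wire (v, 0)).1.2
  have h3 := (g.wire (v, 0)).2.2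
  have h4 := (g.wire (v, 1)).1.2
  have h5 := (g.wire (v, 1)).2.2
  simp only [List.mem_cons, List.not_mem_nil, or_false] at hi
  rcases hi with rfl | rfl | rfl | rfl | rfl | rfl | rfl | rfl <;>
    simp only [Sum.elim_inl, Sum.elim_inr, id] <;> omega

theorem clauseKeys_eq_map (B n : ℕ) :
    clauseKeys B n = ((clauseKeys 0 n).map Sum.inl).map (itemValue B) := by
  rcases n with _ | _ | _ | n <;> simp [clauseKeys, itemValue]

theorem clauseSize_le (n : ℕ) : clauseSize n ≤ 6 := by
  rcases n with _ | _ | _ | n <;> simp [clauseSize]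

theorem clauseWeight_le (n : ℕ) : clauseWeight n ≤ 4 := by
  rcases n with _ | _ | _ | n <;> simp [clauseWeight]

end Gadget

/-- The string for an entry `(variable, key)`: the key in unary, and the binary digits of the
variable, most significant first; both are followed by a comma. -/
def entryCode (e : ℕ × ℕ) : List Γ' :=
  List.replicate e.2 Γ'.blank ++ Γ'.comma :: ((e.1.bits.map Γ'.bit).reverse ++ [Γ'.comma])

/-- The stacks after part of a circuit has been written: the keys of the vertices, the edges, the
number of vertices and the number of cycles. -/
def circuitMem (ks es : List ℕ) (n t : ℕ) : Mem where
  keys := (encodeNats ks).reverse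
  edges := (encodeNats es).reverse
  size := List.replicate n Γ'.blank
  target := List.replicate t Γ'.blank

/-- The stacks while the formula is read: part of a circuit, the part of the formula that has not
been read, and the entries of the literals. -/
def readMem (ks es : List ℕ) (n t : ℕ) (inp ent : List Γ') : Mem :=
  { circuitMem ks es n t with input := inp, entries := ent }

namespace Prog

/-- Appends the number of an item to the string that is written backwards on the given stack; the
base is the present number of vertices. -/
def emitItem (dst : Reg) : ℕ ⊕ ℕ → Prog
  | .inl c =>
    seq (pushList .size (List.replicate c Γ'.blank)) (seq (emit .size dst) (popMany .size c))
  | .inr c => pushList dst (encodeBinary c)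

/-- Appends the numbers of a list of items. -/
def emitItems (dst : Reg) : List (ℕ ⊕ ℕ) → Prog
  | [] => skip
  | i :: l => seq (emitItem dst i) (emitItems dst l)

theorem run_emitItem {dst : Reg} (hd : scratch dst = false) (hs : dst ≠ .size) (i : ℕ ⊕ ℕ)
    {n N : ℕ} (hN : n + i.elim id id ≤ N) (m : Mem) (hn : m.size = List.replicate n Γ'.blank)
    (h1 : m.counter = []) (h2 : m.carry = []) (h3 : m.temp = []) :
    Run (emitItem dst i) m (m.set dst ((encodeBinary (Gadget.itemValue n i)).reverse ++ m.get dst))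
      (11 * (N + 1) ^ 2) := by
  rcases i with c | c
  · have hN : n + c ≤ N := hN
    refine ((run_pushList .size _ m).seq ((run_emit (src := .size) rfl hd hs.symm (n + c)
      (m.set .size ((List.replicate c Γ'.blank).reverse ++ m.get .size)) ?_ h1 h2 h3).seq
      (run_popMany .size c _))).congr ?_ ?_
    · rw [Mem.get_set_self, List.reverse_replicate]
      change _ ++ m.size = _
      rw [hn, List.replicate_append_replicate, add_comm]
    · refine Mem.ext_get fun k => ?_
      have hn : m.get .size = List.replicate n Γ'.blank := hn
      simp only [Mem.get_set, Function.update_apply]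
      split_ifs <;> simp_all [Gadget.itemValue]
    · have : (n + c + 1) ^ 2 ≤ (N + 1) ^ 2 := Nat.pow_le_pow_left (by omega) 2
      rw [List.length_replicate]
      nlinarith
  · have hN : n + c ≤ N := hN
    refine (run_pushList dst (encodeBinary c) m).congr rfl ?_
    have := length_bits_le c
    simp only [encodeBinary, List.length_append, List.length_map, List.length_singleton]
    nlinarith

theorem run_emitItems {dst : Reg} (hd : scratch dst = false) (hs : dst ≠ .size) (l : List (ℕ ⊕ ℕ))
    {n N : ℕ} (hN : ∀ i ∈ l, n + i.elim id id ≤ N) (m : Mem)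
    (hn : m.size = List.replicate n Γ'.blank)
    (h1 : m.counter = []) (h2 : m.carry = []) (h3 : m.temp = []) :
    Run (emitItems dst l) m
      (m.set dst ((encodeNats (l.map (Gadget.itemValue n))).reverse ++ m.get dst))
      (l.length * (11 * (N + 1) ^ 2) + 1) := by
  induction l generalizing m with
  | nil => exact (Run.skip m).congr (by simp [encodeNats]) (by simp)
  | cons i l ih =>
    have hne : ∀ k, scratch k = true → k ≠ dst := by
      rintro k hk rfl
      simp_all
    refine ((run_emitItem hd hs i (hN i List.mem_cons_self) m hn h1 h2 h3).seq
      (ih (fun i hi => hN i (List.mem_cons_of_mem _ hi)) _ ?_ ?_ ?_ ?_)).congr ?_ ?_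
    · exact (Mem.get_set_of_ne m hs.symm _).trans hn
    · exact (Mem.get_set_of_ne m (hne .counter rfl) _).trans h1
    · exact (Mem.get_set_of_ne m (hne .carry rfl) _).trans h2
    · exact (Mem.get_set_of_ne m (hne .temp rfl) _).trans h3
    · simp [encodeNats_cons]
    · rw [List.length_cons]
      linarith

/-- Appends the gadget of a clause with the given signs to the circuit. -/
def emitClause (s : List Bool) : Prog :=
  seq (emitItems .edges (Gadget.clauseGadget 0 s).edgeItems)
    (seq (emitItems .keys ((Gadget.clauseKeys 0 s.length).map Sum.inl))
      (seq (pushList .size (List.replicate (Gadget.clauseSize s.length) Γ'.blank))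
        (pushList .target (List.replicate (Gadget.clauseWeight s.length) Γ'.blank))))

theorem run_emitClause (s : List Bool) (ks es : List ℕ) (n t N : ℕ) (hN : n + 6 ≤ N)
    (inp ent : List Γ') :
    Run (emitClause s) (readMem ks es n t inp ent)
      (readMem (ks ++ Gadget.clauseKeys n s.length) (es ++ (Gadget.clauseGadget n s).edges n)
        (n + Gadget.clauseSize s.length) (t + Gadget.clauseWeight s.length) inp ent)
      (700 * (N + 1) ^ 2) := by
  have hsize := Gadget.clauseSize_le s.length
  have hweight := Gadget.clauseWeight_le s.length
  have hg : (Gadget.clauseGadget 0 s).size = Gadget.clauseSize s.length := rfl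
  refine ((run_emitItems (dst := .edges) rfl (by decide) _ (n := n) (N := N) ?_ _ rfl rfl rfl
    rfl).seq ((run_emitItems (dst := .keys) rfl (by decide) _ (n := n) (N := N) ?_ _ rfl rfl rfl
    rfl).seq ((run_pushList _ _ _).seq (run_pushList _ _ _)))).congr ?_ ?_
  · intro i hi
    have := Gadget.edgeItems_le _ i hi
    omega
  · intro i hi
    obtain ⟨k, hk, rfl⟩ := List.mem_map.1 hi
    have := (Gadget.clauseKeys_bounds hk).2
    simp only [Sum.elim_inl, id]
    omega
  · rw [← Gadget.clauseKeys_eq_map, ← Gadget.edges_eq_map_itemValue]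
    have he : (Gadget.clauseGadget 0 s).edges n = (Gadget.clauseGadget n s).edges n := rfl
    rw [he]
    simp only [Mem.set, Mem.get, readMem, circuitMem, encodeNats_append, List.reverse_append,
      List.reverse_replicate, List.replicate_append_replicate, add_comm]
  · have h1 := Gadget.length_edgeItems (Gadget.clauseGadget 0 s)
    have h2 : (Gadget.clauseKeys 0 s.length).length = _ := Gadget.length_clauseKeys _ _
    rw [h1, List.length_map, h2, hg, List.length_replicate, List.length_replicate]
    generalize Gadget.clauseSize s.length = a at *
    generalize Gadget.clauseWeight s.length = b at *
    have : a * (11 * (N + 1) ^ 2) ≤ 6 * (11 * (N + 1) ^ 2) := Nat.mul_le_mul_right _ hsize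
    nlinarith

/-- Reads a literal whose sign has been read already, and adds an entry for it; it is the `i`-th
literal of its clause. -/
def readLiteral (i : ℕ) : Prog :=
  seq (push .entries Γ'.comma)
    (seq (popWhile .input (fun o => o != some Γ'.comma) fun o => push .entries (o.getD Γ'.comma))
      (seq (move .size .temp)
        (seq (loop .temp fun a => seq (push .size a) (push .entries Γ'.blank))
          (pushList .entries (List.replicate i Γ'.blank)))))

theorem run_readLiteral (i x : ℕ) (m : Mem) (n N : ℕ) (inp : List Γ') (hN : n + i ≤ N)
    (hx : x.bits.length ≤ N) (hi : m.input = encodeBinary x ++ inp)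
    (hn : m.size = List.replicate n Γ'.blank) (ht : m.temp = []) :
    Run (readLiteral i) m
      { m with input := inp, entries := entryCode (x, n + i) ++ m.entries } (10 * (N + 1)) := by
  have h1 : ∀ (l : List Bool) (m : Mem), m.input = l.map Γ'.bit ++ Γ'.comma :: inp →
      Run (popWhile .input (fun o => o != some Γ'.comma) fun o => push .entries (o.getD Γ'.comma)) m
        { m with input := inp, entries := Γ'.comma :: ((l.map Γ'.bit).reverse ++ m.entries) }
        (2 * l.length + 2) := by
    intro l
    induction l with
    | nil =>
      intro m hm
      obtain ⟨⟩ := m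
      subst hm
      exact (Run.popStop rfl (Run.push _ _ _)).congr rfl (by simp)
    | cons a l ih =>
      intro m hm
      obtain ⟨⟩ := m
      subst hm
      refine (Run.popStep rfl (Run.push _ _ _) (ih _ rfl)).congr ?_ (by simp; omega)
      simp [Mem.get, Mem.set]
  have h2 : ∀ (c : ℕ) (m : Mem), m.temp = List.replicate c Γ'.blank →
      Run (loop .temp fun a => seq (push .size a) (push .entries Γ'.blank)) m
        { m with
          temp := []
          size := List.replicate c Γ'.blank ++ m.size
          entries := List.replicate c Γ'.blank ++ m.entries } (3 * c + 2) := by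
    intro c
    induction c with
    | zero =>
      intro m hm
      obtain ⟨⟩ := m
      subst hm
      exact (Run.loop_nil rfl).congr rfl le_rfl
    | succ c ih =>
      intro m hm
      obtain ⟨⟩ := m
      subst hm
      refine (Run.loop_cons (k := .temp) (f := fun a => seq (push .size a) (push .entries Γ'.blank))
        rfl ((Run.push _ _ _).seq (Run.push _ _ _)) (ih _ rfl)).congr ?_ (by omega)
      simp [Mem.get, Mem.set, List.replicate_succ']
  obtain ⟨⟩ := m
  simp only at hi hn ht
  subst hi hn ht
  refine ((Run.push _ _ _).seq ((h1 x.bits _ ?_).seq ((run_move (by decide) _).seq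
    ((h2 n _ ?_).seq (run_pushList _ _ _))))).congr ?_ ?_
  · simp [Mem.set, encodeBinary]
  · simp [Mem.set, Mem.get]
  · simp only [Mem.set, Mem.get, entryCode, List.reverse_replicate, List.append_nil,
      List.append_assoc, List.cons_append, List.nil_append]
    rw [← List.append_assoc, List.replicate_append_replicate, add_comm]
  · simp only [Mem.set, Mem.get, List.length_replicate]
    omega

/-- Reads the literals of a clause, of which those with the given signs have been read already. -/
def readLiterals (s : List Bool) : ℕ → Prog
  | 0 => skip
  | fuel + 1 => case .input fun
    | some (Γ'.bit b) => seq (readLiteral s.length) (readLiterals (s ++ [b]) fuel)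
    | _ => emitClause s

theorem run_readLiterals (C : List Literal) (s s' : List Bool)
    (hs : s' = s ++ C.map Literal.positive) (fuel : ℕ) (hf : C.length < fuel)
    (ks es : List ℕ) (n t N : ℕ) (hN : n + C.length + s.length + 6 ≤ N)
    (hC : ∀ x ∈ C, x.var.bits.length ≤ N) (inp ent : List Γ') :
    Run (readLiterals s fuel)
      (readMem ks es n t ((C.map ThreeCNF.encodeLiteral).flatten ++ Γ'.ket :: inp) ent)
      (readMem (ks ++ Gadget.clauseKeys n s'.length) (es ++ (Gadget.clauseGadget n s').edges n)
        (n + Gadget.clauseSize s'.length) (t + Gadget.clauseWeight s'.length) inp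
        (((C.map Literal.var).zipIdx (n + s.length)).reverse.flatMap entryCode ++ ent))
      (C.length * (10 * (N + 1) + 1) + 700 * (N + 1) ^ 2 + 1) := by
  induction C generalizing s fuel ent with
  | nil =>
    obtain ⟨fuel, rfl⟩ := Nat.exists_eq_succ_of_ne_zero (by omega : fuel ≠ 0)
    obtain rfl : s' = s := by simpa using hs
    exact (Run.case (run_emitClause s' ks es n t N (by omega) inp ent)).congr rfl (by simp)
  | cons x C ih =>
    obtain ⟨fuel, rfl⟩ := Nat.exists_eq_succ_of_ne_zero (by omega : fuel ≠ 0)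
    rw [List.length_cons] at hN hf
    have h1 := run_readLiteral s.length x.var
      (readMem ks es n t
        (encodeBinary x.var ++ ((C.map ThreeCNF.encodeLiteral).flatten ++ Γ'.ket :: inp)) ent)
      n N _ (by omega) (hC x List.mem_cons_self) rfl rfl rfl
    have h2 := ih (s ++ [x.positive]) (by simp [hs]) fuel (by omega) (by simp; omega)
      (fun y hy => hC y (List.mem_cons_of_mem _ hy)) (entryCode (x.var, n + s.length) ++ ent)
    have h3 := Run.case (k := .input) (f := fun
        | some (Γ'.bit b) => seq (readLiteral s.length) (readLiterals (s ++ [b]) fuel)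
        | _ => emitClause s)
      (m := readMem ks es n t (Γ'.bit x.positive ::
        (encodeBinary x.var ++ ((C.map ThreeCNF.encodeLiteral).flatten ++ Γ'.ket :: inp))) ent)
      (h1.seq h2)
    rw [List.map_cons, List.flatten_cons, ThreeCNF.encodeLiteral, List.append_assoc]
    refine h3.congr ?_ ?_
    · simp [add_assoc]
    · rw [List.length_cons]
      linarith

/-- Reads the clauses and writes their gadgets and the entries of their literals. -/
def readClauses : Prog := loop .input fun _ => readLiterals [] 4

theorem run_readClauses (l : List (List Literal)) (hl : ∀ C ∈ l, C.length ≤ 3) (ks es : List ℕ)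
    (n t N : ℕ) (hN : n + (l.map fun C => Gadget.clauseSize C.length).sum + 9 ≤ N)
    (hvar : ∀ C ∈ l, ∀ x ∈ C, x.var.bits.length ≤ N) (ent : List Γ') :
    Run readClauses
      (readMem ks es n t (l.map ThreeCNF.encodeClause).flatten ent)
      (readMem (ks ++ (Gadget.clauseGadgets n l).flatMap Gadget.keys)
        (es ++ Gadget.joinEdges n (Gadget.clauseGadgets n l))
        (n + (l.map fun C => Gadget.clauseSize C.length).sum)
        (t + (l.map fun C => Gadget.clauseWeight C.length).sum) []
        ((Gadget.clauseEntries n l).reverse.flatMap entryCode ++ ent))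
      (l.length * (800 * (N + 1) ^ 2) + 2) := by
  induction l generalizing ks es n t ent with
  | nil =>
    refine (Run.loop_nil rfl).congr ?_ (by simp)
    simp [Gadget.clauseGadgets, Gadget.clauseEntries, Gadget.joinEdges]
  | cons C l ih =>
    have hC := hl C List.mem_cons_self
    rw [List.map_cons, List.sum_cons] at hN
    have h1 := run_readLiterals C [] _ rfl 4 (by omega) ks es n t N (by simp; omega)
      (hvar C List.mem_cons_self) (l.map ThreeCNF.encodeClause).flatten ent
    have h2 := ih (fun C hC => hl C (List.mem_cons_of_mem _ hC))
      (ks ++ Gadget.clauseKeys n C.length)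
      (es ++ (Gadget.clauseGadget n (C.map Literal.positive)).edges n)
      (n + Gadget.clauseSize C.length) (t + Gadget.clauseWeight C.length) (by omega)
      (fun C hC => hvar C (List.mem_cons_of_mem _ hC))
      (((C.map Literal.var).zipIdx n).reverse.flatMap entryCode ++ ent)
    simp only [List.nil_append, List.length_map, List.length_nil, add_zero] at h1
    have h3 := Run.loop_cons (k := .input) (f := fun _ => readLiterals [] 4)
      (m := readMem ks es n t (Γ'.bra :: ((C.map ThreeCNF.encodeLiteral).flatten ++
        Γ'.ket :: (l.map ThreeCNF.encodeClause).flatten)) ent) rfl h1 h2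
    rw [List.map_cons, List.flatten_cons, ThreeCNF.encodeClause, List.cons_append,
      List.append_assoc, List.singleton_append]
    refine h3.congr ?_ ?_
    · rw [Gadget.keys_clauseGadgets_cons _ _ _ hC]
      simp [Gadget.clauseGadgets, Gadget.clauseEntries, Gadget.joinEdges, Gadget.clauseGadget,
        add_assoc, List.append_assoc]
    · rw [List.length_cons]
      have : C.length * (10 * (N + 1) + 1) ≤ 3 * (10 * (N + 1) + 1) := Nat.mul_le_mul_right _ hC
      nlinarith

end Prog

/-! ### The program that identifies the occurrences -/

/-- The stacks while the occurrences are identified. -/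
def roundMem (ks es : List ℕ) (n t : ℕ) (ent rest word first second cand diff : List Γ') : Mem :=
  { circuitMem ks es n t with
    entries := ent
    rest := rest
    word := word
    first := first
    second := second
    cand := cand
    diff := diff }

namespace Prog

/-- Reads the key of an entry. -/
def readKey (dst : Reg) : Prog :=
  popWhile .entries (· == some Γ'.blank) fun
    | some Γ'.blank => push dst Γ'.blank
    | _ => skip

theorem run_readKey {dst : Reg} (hd : dst ≠ .entries) (r : ℕ) (s : List Γ') (m : Mem)
    (hm : m.get .entries = List.replicate r Γ'.blank ++ Γ'.comma :: s) :
    Run (readKey dst) m ((m.set .entries s).set dst (List.replicate r Γ'.blank ++ m.get dst))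
      (2 * r + 2) := by
  induction r generalizing m with
  | zero =>
    refine (Run.popStop (t := 1) (by rw [hm]; rfl) (m' := m.set .entries s) ?_).congr ?_ le_rfl
    · rw [hm]
      exact Run.skip _
    · rw [List.replicate_zero, List.nil_append, ← Mem.get_set_of_ne m hd s, Mem.set_get]
  | succ r ih =>
    refine (Run.popStep (t := 1) (by rw [hm]; rfl) ?_
      (ih ((m.set .entries (List.replicate r Γ'.blank ++ Γ'.comma :: s)).set dst
        (Γ'.blank :: m.get dst)) ?_)).congr ?_ ?_
    · rw [hm]
      refine (Run.push _ _ _).congr ?_ le_rfl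
      rw [Mem.get_set_of_ne _ hd]
      rfl
    · rw [Mem.get_set_of_ne _ hd.symm, Mem.get_set_self]
    · refine Mem.ext_get fun k => ?_
      simp only [Mem.get_set, Function.update_apply]
      split_ifs <;> simp_all [List.replicate_succ']
    · omega

/-- Reads the variable of an entry. -/
def readVar (dst : Reg) : Prog :=
  popWhile .entries (· != some Γ'.comma) fun
    | some (Γ'.bit b) => push dst (Γ'.bit b)
    | _ => skip

theorem run_readVar {dst : Reg} (hd : dst ≠ .entries) (l : List Bool) (s : List Γ') (m : Mem)
    (hm : m.get .entries = l.map Γ'.bit ++ Γ'.comma :: s) :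
    Run (readVar dst) m ((m.set .entries s).set dst ((l.map Γ'.bit).reverse ++ m.get dst))
      (2 * l.length + 2) := by
  induction l generalizing m with
  | nil =>
    refine (Run.popStop (t := 1) (by rw [hm]; rfl) (m' := m.set .entries s) ?_).congr ?_ le_rfl
    · rw [hm]
      exact Run.skip _
    · rw [List.map_nil, List.reverse_nil, List.nil_append, ← Mem.get_set_of_ne m hd s, Mem.set_get]
  | cons b l ih =>
    refine (Run.popStep (t := 1) (by rw [hm]; rfl) ?_
      (ih ((m.set .entries (l.map Γ'.bit ++ Γ'.comma :: s)).set dst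
        (Γ'.bit b :: m.get dst)) ?_)).congr ?_ ?_
    · rw [hm]
      refine (Run.push _ _ _).congr ?_ le_rfl
      rw [Mem.get_set_of_ne _ hd]
      rfl
    · rw [Mem.get_set_of_ne _ hd.symm, Mem.get_set_self]
    · refine Mem.ext_get fun k => ?_
      simp only [Mem.get_set, Function.update_apply]
      split_ifs <;> simp_all
    · simp only [List.length_cons]
      omega

/-- The number of positions of `w` at which `c` has a different symbol or ends. -/
def mismatches : List Γ' → List Γ' → ℕ
  | [], _ => 0
  | _ :: w, [] => mismatches w [] + 1
  | a :: w, b :: c => mismatches w c + if a = b then 0 else 1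

theorem mismatches_add_eq_zero_iff (w c : List Γ') :
    mismatches w c + (c.drop w.length).length = 0 ↔ w = c := by
  induction w generalizing c with
  | nil => cases c <;> simp [mismatches]
  | cons a w ih =>
    cases c with
    | nil => simp [mismatches]
    | cons b c =>
      rw [List.cons.injEq, ← ih c]
      simp only [mismatches, List.length_cons, List.drop_succ_cons]
      split_ifs with h <;> simp [h]

/-- Compares `word` with `cand`: afterwards `diff` is empty if and only if they are equal. -/
def compare : Prog :=
  seq (loop .word fun a => seq (push .temp a) (case .cand fun
      | some b => seq (push .counter b) (if a = b then skip else push .diff Γ'.blank)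
      | none => push .diff Γ'.blank))
    (seq (loop .cand fun b => seq (push .counter b) (push .diff Γ'.blank))
      (seq (move .temp .word) (move .counter .cand)))

theorem run_compare (ks es : List ℕ) (n t : ℕ) (ent rest w first second c : List Γ') :
    Run compare (roundMem ks es n t ent rest w first second c [])
      (roundMem ks es n t ent rest w first second c
        (List.replicate (mismatches w c + (c.drop w.length).length) Γ'.blank))
      (7 * w.length + 7 * c.length + 8) := by
  have h1 : ∀ (w c : List Γ') (m : Mem), m.word = w → m.cand = c →
      Run (loop .word fun a => seq (push .temp a) (case .cand fun
        | some b => seq (push .counter b) (if a = b then skip else push .diff Γ'.blank)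
        | none => push .diff Γ'.blank)) m
        { m with
          word := []
          cand := c.drop w.length
          temp := w.reverse ++ m.temp
          counter := (c.take w.length).reverse ++ m.counter
          diff := List.replicate (mismatches w c) Γ'.blank ++ m.diff } (5 * w.length + 2) := by
    intro w
    induction w with
    | nil =>
      intro c m hw hc
      obtain ⟨⟩ := m
      subst hw hc
      exact (Run.loop_nil rfl).congr rfl (by simp)
    | cons a w ih =>
      intro c m hw hc
      obtain ⟨⟩ := m
      subst hw hc
      rename_i c _ _ _ _
      cases c with
      | nil =>
        refine (Run.loop_cons (k := .word) rfl ((Run.push _ _ _).seq (Run.case (Run.push _ _ _)))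
          (ih [] _ rfl rfl)).congr ?_ (by simp; omega)
        simp [Mem.get, Mem.set, mismatches, List.replicate_succ']
      | cons b c =>
        have hb : ∀ m : Mem, Run (if a = b then skip else push .diff Γ'.blank) m
            { m with diff := List.replicate (if a = b then 0 else 1) Γ'.blank ++ m.diff } 1 := by
          intro m
          split_ifs
          exacts [Run.skip m, Run.push _ _ m]
        refine (Run.loop_cons (k := .word) rfl ((Run.push _ _ _).seq
          (Run.case ((Run.push _ _ _).seq (hb _)))) (ih c _ rfl rfl)).congr ?_ (by simp; omega)
        simp [Mem.get, Mem.set, mismatches, ← List.replicate_append_replicate]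
  have h2 : ∀ (c : List Γ') (m : Mem), m.cand = c →
      Run (loop .cand fun b => seq (push .counter b) (push .diff Γ'.blank)) m
        { m with
          cand := []
          counter := c.reverse ++ m.counter
          diff := List.replicate c.length Γ'.blank ++ m.diff } (3 * c.length + 2) := by
    intro c
    induction c with
    | nil =>
      intro m hc
      obtain ⟨⟩ := m
      subst hc
      exact (Run.loop_nil rfl).congr rfl le_rfl
    | cons b c ih =>
      intro m hc
      obtain ⟨⟩ := m
      subst hc
      refine (Run.loop_cons (k := .cand)
        (f := fun b => seq (push .counter b) (push .diff Γ'.blank)) rfl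
        ((Run.push _ _ _).seq (Run.push _ _ _)) (ih _ rfl)).congr ?_ (by simp; omega)
      simp [Mem.get, Mem.set, List.replicate_succ']
  refine ((h1 w c _ rfl rfl).seq ((h2 _ _ rfl).seq ((run_move (by decide) _).seq
    (run_move (by decide) _)))).congr ?_ ?_
  · simp [Mem.get, Mem.set, roundMem, circuitMem, ← List.reverse_append, add_comm]
  · simp [Mem.get, Mem.set, roundMem, circuitMem]
    omega

/-- Adds a gadget that identifies two occurrences. -/
def identify : Prog :=
  seq (emit .first .keys) (seq (emit .second .keys)
    (seq (emitItems .edges (Gadget.eqGadget 0 0).edgeItems)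
      (seq (pushList .size (List.replicate 2 Γ'.blank))
        (seq (pushList .target (List.replicate 2 Γ'.blank))
          (seq (clear .cand) (seq (clear .first) (move .second .first)))))))

theorem run_identify (ks es : List ℕ) (n t : ℕ) (ent rest w c : List Γ') (p q N : ℕ) (hp : p ≤ N)
    (hq : q ≤ N) (hn : n + 2 ≤ N) (hc : c.length ≤ N) :
    Run identify
      (roundMem ks es n t ent rest w (List.replicate p Γ'.blank) (List.replicate q Γ'.blank) c [])
      (roundMem (ks ++ [p, q]) (es ++ (Gadget.eqGadget p q).edges n) (n + 2) (t + 2) ent rest w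
        (List.replicate q Γ'.blank) [] [] []) (220 * (N + 1) ^ 2) := by
  refine ((run_emit rfl rfl (by decide) p _ rfl rfl rfl rfl).seq
    ((run_emit rfl rfl (by decide) q _ rfl rfl rfl rfl).seq
    ((run_emitItems (dst := .edges) rfl (by decide) _ (n := n) (N := N) ?_ _ rfl rfl rfl rfl).seq
    ((run_pushList _ _ _).seq ((run_pushList _ _ _).seq ((run_clear _ _).seq ((run_clear _ _).seq
    (run_move (by decide) _)))))))).congr ?_ ?_
  · intro i hi
    have := Gadget.edgeItems_le _ i hi
    exact (Nat.add_le_add_left this n).trans hn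
  · rw [← Gadget.edges_eq_map_itemValue]
    have he : (Gadget.eqGadget 0 0).edges n = (Gadget.eqGadget p q).edges n := rfl
    rw [he]
    simp only [Mem.set, Mem.get, roundMem, circuitMem, encodeNats_append, List.reverse_append,
      List.reverse_replicate, List.replicate_append_replicate, add_comm, List.append_nil]
    simp [encodeNats]
  · have h1 : (Gadget.eqGadget 0 0).edgeItems.length = 16 := Gadget.length_edgeItems _
    have h2 : (p + 1) ^ 2 ≤ (N + 1) ^ 2 := Nat.pow_le_pow_left (by omega) 2
    have h3 : (q + 1) ^ 2 ≤ (N + 1) ^ 2 := Nat.pow_le_pow_left (by omega) 2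
    simp only [Mem.set, Mem.get, roundMem, circuitMem, List.length_replicate, h1]
    nlinarith

/-- Puts an entry back. -/
def putBack : Prog :=
  seq (clear .diff) (seq (push .rest Γ'.comma) (seq (move .cand .rest)
    (seq (push .rest Γ'.comma) (move .second .rest))))

theorem run_putBack (ks es : List ℕ) (n t : ℕ) (ent rest w first d : List Γ') (e : ℕ × ℕ) :
    Run putBack
      (roundMem ks es n t ent rest w first (List.replicate e.2 Γ'.blank) (e.1.bits.map Γ'.bit) d)
      (roundMem ks es n t ent (entryCode e ++ rest) w first [] [] [])
      (2 * d.length + 2 * e.1.bits.length + 2 * e.2 + 8) := by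
  refine ((run_clear _ _).seq ((Run.push _ _ _).seq ((run_move (by decide) _).seq
    ((Run.push _ _ _).seq (run_move (by decide) _))))).congr ?_ ?_
  · simp [Mem.get, Mem.set, roundMem, circuitMem, entryCode]
  · simp [Mem.get, Mem.set, roundMem, circuitMem]
    omega

/-- Takes the first entry off the list of entries, and identifies its occurrence with the last
occurrence of the present variable, or puts it back, depending on its variable. -/
def scanStep : Prog :=
  seq (readKey .second) (seq (readVar .cand) (seq compare (case .diff fun
    | none => identify
    | some _ => putBack)))

theorem length_mismatches_le (w c : List Γ') :
    mismatches w c + (c.drop w.length).length ≤ w.length + c.length := by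
  induction w generalizing c with
  | nil => simp [mismatches]
  | cons a w ih =>
    cases c with
    | nil => simpa [mismatches] using ih []
    | cons b c =>
      have := ih c
      simp only [mismatches, List.length_cons, List.drop_succ_cons]
      split_ifs <;> omega

/-- Reading and comparing the next entry, continued by any program `q`. -/
theorem run_readEntry_compare (ks es : List ℕ) (n t : ℕ) (ent rest w first : List Γ') (e : ℕ × ℕ)
    {q : Prog} {m : Mem} {T d : ℕ} (hd : mismatches w (e.1.bits.map Γ'.bit) +
      ((e.1.bits.map Γ'.bit).drop w.length).length = d)
    (h : Run q (roundMem ks es n t ent rest w first (List.replicate e.2 Γ'.blank)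
        (e.1.bits.map Γ'.bit) (List.replicate d Γ'.blank)) m T) :
    Run (seq (readKey .second) (seq (readVar .cand) (seq compare q)))
      (roundMem ks es n t (entryCode e ++ ent) rest w first [] [] []) m
      (2 * e.2 + 7 * w.length + 9 * e.1.bits.length + 12 + T) := by
  have h1 := run_readKey (dst := .second) (by decide) e.2
    ((e.1.bits.map Γ'.bit).reverse ++ Γ'.comma :: ent)
    (roundMem ks es n t (entryCode e ++ ent) rest w first [] [] []) (by
      simp [Mem.get, roundMem, entryCode])
  have h2 := run_readVar (dst := .cand) (by decide) e.1.bits.reverse ent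
    (roundMem ks es n t ((e.1.bits.map Γ'.bit).reverse ++ Γ'.comma :: ent) rest w first
      (List.replicate e.2 Γ'.blank) [] []) (by simp [Mem.get, roundMem])
  have h3 := run_compare ks es n t ent rest w first (List.replicate e.2 Γ'.blank)
    (e.1.bits.map Γ'.bit)
  rw [hd] at h3
  refine ((h1.congr ?_ le_rfl).seq ((h2.congr ?_ le_rfl).seq (h3.seq h))).congr rfl ?_
  · simp [Mem.get, Mem.set, roundMem, circuitMem]
  · simp [Mem.get, Mem.set, roundMem, circuitMem]
  · simp
    omega

theorem run_scanStep_eq (ks es : List ℕ) (n t : ℕ) (ent rest : List Γ') (x p r N : ℕ)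
    (hp : p ≤ N) (hr : r ≤ N) (hx : x.bits.length ≤ N) (hn : n + 2 ≤ N) :
    Run scanStep
      (roundMem ks es n t (entryCode (x, r) ++ ent) rest (x.bits.map Γ'.bit)
        (List.replicate p Γ'.blank) [] [] [])
      (roundMem (ks ++ [p, r]) (es ++ (Gadget.eqGadget p r).edges n) (n + 2) (t + 2) ent rest
        (x.bits.map Γ'.bit) (List.replicate r Γ'.blank) [] [] []) (300 * (N + 1) ^ 2) := by
  have h1 := run_identify ks es n t ent rest (x.bits.map Γ'.bit) (x.bits.map Γ'.bit) p r N hp hr hn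
    (by simpa using hx)
  have h2 := Run.case (k := .diff) (f := fun
    | none => identify
    | some _ => putBack) (m := roundMem ks es n t ent rest (x.bits.map Γ'.bit)
        (List.replicate p Γ'.blank) (List.replicate r Γ'.blank) (x.bits.map Γ'.bit) []) h1
  refine (run_readEntry_compare ks es n t ent rest _ _ (x, r)
    ((mismatches_add_eq_zero_iff _ _).2 rfl) h2).congr rfl ?_
  simp only [List.length_map]
  nlinarith

theorem run_scanStep_ne (ks es : List ℕ) (n t : ℕ) (ent rest first : List Γ') (x : ℕ) (e : ℕ × ℕ)
    (N : ℕ) (hr : e.2 ≤ N) (hx : x.bits.length ≤ N) (he : e.1.bits.length ≤ N) (hne : e.1 ≠ x) :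
    Run scanStep
      (roundMem ks es n t (entryCode e ++ ent) rest (x.bits.map Γ'.bit) first [] [] [])
      (roundMem ks es n t ent (entryCode e ++ rest) (x.bits.map Γ'.bit) first [] [] [])
      (300 * (N + 1) ^ 2) := by
  have h0 := length_mismatches_le (x.bits.map Γ'.bit) (e.1.bits.map Γ'.bit)
  have hm : mismatches (x.bits.map Γ'.bit) (e.1.bits.map Γ'.bit) +
      ((e.1.bits.map Γ'.bit).drop (x.bits.map Γ'.bit).length).length ≠ 0 := by
    rw [Ne, mismatches_add_eq_zero_iff]
    intro h
    exact hne (bits_injective (List.map_injective_iff.2 (fun a b h => by simpa using h) h)).symm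
  obtain ⟨d, hd⟩ := Nat.exists_eq_succ_of_ne_zero hm
  have h1 := run_putBack ks es n t ent rest (x.bits.map Γ'.bit) first (List.replicate d Γ'.blank) e
  have h2 := Run.case (k := .diff) (f := fun
    | none => identify
    | some _ => putBack) (m := roundMem ks es n t ent rest (x.bits.map Γ'.bit)
        first (List.replicate e.2 Γ'.blank) (e.1.bits.map Γ'.bit)
        (List.replicate (d + 1) Γ'.blank)) h1
  have h3 := run_readEntry_compare ks es n t ent rest (x.bits.map Γ'.bit) first e hd h2
  refine h3.congr rfl ?_
  rw [hd] at h0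
  simp only [List.length_map, List.length_replicate] at *
  nlinarith

/-- Goes through the list of entries for one variable. -/
def scan : Prog := loop .entries fun a => seq (push .entries a) scanStep

theorem exists_entryCode_append (e : ℕ × ℕ) (s : List Γ') : ∃ a l, entryCode e ++ s = a :: l := by
  obtain ⟨x, r⟩ := e
  cases r <;> exact ⟨_, _, rfl⟩

/-- A program that starts with a nonempty stack, inside a loop that pops this stack. -/
theorem Run.loop_push {k : Reg} {p : Prog} {m m' m'' : Mem} {t t' : ℕ} (h : ∃ a l, m.get k = a :: l)
    (h₁ : Run p m m' t) (h₂ : Run (loop k fun a => Prog.seq (Prog.push k a) p) m' m'' t') :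
    Run (loop k fun a => Prog.seq (Prog.push k a) p) m m'' (t + t' + 2) := by
  obtain ⟨a, l, h⟩ := h
  have h0 : Run (Prog.push k a) (m.set k l) m 1 := by
    refine (Run.push k a _).congr ?_ le_rfl
    rw [Mem.get_set_self, Mem.set_set, ← h, Mem.set_get]
  have h3 := Run.loop_cons (f := fun a => Prog.seq (Prog.push k a) p) h (h0.seq h₁) h₂
  exact h3.mono (by omega)

theorem run_scan (ks es : List ℕ) (n t : ℕ) (rest : List Γ') (x p N : ℕ) (L : List (ℕ × ℕ))
    (hp : p ≤ N) (hx : x.bits.length ≤ N) (hL : ∀ e ∈ L, e.1.bits.length ≤ N ∧ e.2 ≤ N)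
    (hn : n + 2 * (occurrencesOf x L).length ≤ N) :
    Run scan
      (roundMem ks es n t (L.flatMap entryCode) rest (x.bits.map Γ'.bit)
        (List.replicate p Γ'.blank) [] [] [])
      (roundMem (ks ++ (chain p (occurrencesOf x L)).flatMap fun p => [p.1, p.2])
        (es ++ Gadget.joinEdges n ((chain p (occurrencesOf x L)).map fun p =>
          Gadget.eqGadget p.1 p.2))
        (n + 2 * (occurrencesOf x L).length) (t + 2 * (occurrencesOf x L).length) []
        ((otherEntries x L).flatMap entryCode ++ rest) (x.bits.map Γ'.bit)
        (List.replicate ((occurrencesOf x L).getLastD p) Γ'.blank) [] [] [])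
      (L.length * (300 * (N + 1) ^ 2 + 2) + 2) := by
  induction L generalizing ks es n t rest p with
  | nil =>
    refine (Run.loop_nil rfl).congr ?_ (by simp)
    simp [occurrencesOf, otherEntries, chain, Gadget.joinEdges]
  | cons e L ih =>
    have hL' := fun e he => hL e (List.mem_cons_of_mem _ he)
    obtain ⟨he, hr⟩ := hL e List.mem_cons_self
    rw [List.flatMap_cons]
    by_cases h : e.1 = x
    · have ho : occurrencesOf x (e :: L) = e.2 :: occurrencesOf x L := by simp [occurrencesOf, h]
      have ho' : otherEntries x (e :: L) = otherEntries x L := by simp [otherEntries, h]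
      rw [ho, List.length_cons] at hn
      obtain ⟨y, r⟩ := e
      obtain rfl : y = x := h
      have h1 := run_scanStep_eq ks es n t (L.flatMap entryCode) rest y p r N hp hr hx (by omega)
      have h2 := ih (ks ++ [p, r]) (es ++ (Gadget.eqGadget p r).edges n) (n + 2) (t + 2) rest r hr
        hL' (by omega)
      refine (Run.loop_push (k := .entries) (exists_entryCode_append _ _) h1 h2).congr ?_ ?_
      · rw [ho, ho']
        simp only [chain, List.length_cons, List.getLastD_cons, List.flatMap_cons, List.map_cons,
          Gadget.joinEdges, List.append_assoc, mul_add, mul_one, add_assoc, add_comm]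
        rfl
      · rw [List.length_cons]
        linarith
    · have ho : occurrencesOf x (e :: L) = occurrencesOf x L := by simp [occurrencesOf, h]
      have ho' : otherEntries x (e :: L) = otherEntries x L ++ [e] := by simp [otherEntries, h]
      rw [ho] at hn
      have h1 := run_scanStep_ne ks es n t (L.flatMap entryCode) rest
        (List.replicate p Γ'.blank) x e N hr hx he h
      have h2 := ih ks es n t (entryCode e ++ rest) p hp hL' hn
      refine (Run.loop_push (k := .entries) (exists_entryCode_append _ _) h1 h2).congr ?_ ?_
      · rw [ho, ho']
        simp
      · rw [List.length_cons]
        linarith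

/-- Identifies the occurrences of one variable, and takes their entries off the list. -/
def round : Prog :=
  seq (readKey .first) (seq (readVar .word) (seq scan (seq (clear .word) (seq (clear .first)
    (seq (move .rest .temp) (move .temp .entries))))))

theorem length_flatMap_entryCode_le (N : ℕ) (L : List (ℕ × ℕ))
    (hL : ∀ e ∈ L, e.1.bits.length ≤ N ∧ e.2 ≤ N) :
    (L.flatMap entryCode).length ≤ L.length * (2 * N + 2) := by
  induction L with
  | nil => simp
  | cons e L ih =>
    have := ih fun e he => hL e (List.mem_cons_of_mem _ he)
    obtain ⟨he, hr⟩ := hL e List.mem_cons_self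
    rw [List.flatMap_cons, List.length_append, List.length_cons]
    simp only [entryCode, List.length_append, List.length_replicate, List.length_cons,
      List.length_reverse, List.length_map, List.length_nil]
    linarith

theorem run_round (ks es : List ℕ) (n t x p N : ℕ) (L : List (ℕ × ℕ))
    (hp : p ≤ N) (hx : x.bits.length ≤ N) (hL : ∀ e ∈ L, e.1.bits.length ≤ N ∧ e.2 ≤ N)
    (hn : n + 2 * (occurrencesOf x L).length ≤ N) :
    Run round
      (readMem ks es n t [] (((x, p) :: L).flatMap entryCode))
      (readMem (ks ++ (chain p (occurrencesOf x L)).flatMap fun p => [p.1, p.2])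
        (es ++ Gadget.joinEdges n ((chain p (occurrencesOf x L)).map fun p =>
          Gadget.eqGadget p.1 p.2))
        (n + 2 * (occurrencesOf x L).length) (t + 2 * (occurrencesOf x L).length) []
        ((otherEntries x L).flatMap entryCode))
      ((L.length + 1) * (350 * (N + 1) ^ 2)) := by
  have h1 := run_readKey (dst := .first) (by decide) p
    ((x.bits.map Γ'.bit).reverse ++ Γ'.comma :: L.flatMap entryCode)
    (readMem ks es n t [] (((x, p) :: L).flatMap entryCode)) (by
      simp [Mem.get, readMem, entryCode])
  have h2 := run_readVar (dst := .word) (by decide) x.bits.reverse (L.flatMap entryCode)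
    (roundMem ks es n t ((x.bits.map Γ'.bit).reverse ++ Γ'.comma :: L.flatMap entryCode) [] []
      (List.replicate p Γ'.blank) [] [] []) (by simp [Mem.get, roundMem])
  have h3 := run_scan ks es n t [] x p N L hp hx hL hn
  refine ((h1.congr ?_ le_rfl).seq ((h2.congr ?_ le_rfl).seq (h3.seq ((run_clear _ _).seq
    ((run_clear _ _).seq ((run_move (by decide) _).seq (run_move (by decide) _))))))).congr ?_ ?_
  · simp [Mem.get, Mem.set, roundMem, readMem, circuitMem]
  · simp [Mem.get, Mem.set, roundMem, circuitMem]
  · simp [Mem.get, Mem.set, roundMem, readMem, circuitMem]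
  · have hlast : (occurrencesOf x L).getLastD p ≤ N := by
      rcases List.mem_cons.1 (List.getLastD_mem_cons (l := occurrencesOf x L) (a := p)) with h | h
      · omega
      · obtain ⟨e, he, h⟩ := List.mem_map.1 h
        rw [← h]
        exact (hL e (List.mem_of_mem_filter he)).2
    have hrest := length_flatMap_entryCode_le N (otherEntries x L) fun e he =>
      hL e (List.mem_of_mem_filter (List.mem_reverse.1 he))
    have hlen : (otherEntries x L).length * (2 * N + 2) ≤ L.length * (2 * N + 2) :=
      Nat.mul_le_mul_right _ (length_otherEntries_le x L)
    simp only [Mem.get, Mem.set, roundMem, circuitMem, List.length_map, List.length_replicate,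
      List.append_nil, List.length_reverse]
    generalize ((otherEntries x L).flatMap entryCode).length = s at *
    nlinarith [Nat.zero_le (L.length * N), Nat.zero_le (L.length * N ^ 2)]

/-- Identifies the occurrences of each variable. -/
def rounds : Prog := loop .entries fun a => seq (push .entries a) round

theorem run_rounds (ks es : List ℕ) (n t N : ℕ) (L : List (ℕ × ℕ))
    (hL : ∀ e ∈ L, e.1.bits.length ≤ N ∧ e.2 ≤ N) (hn : n + 2 * L.length ≤ N) :
    Run rounds
      (readMem ks es n t [] (L.flatMap entryCode))
      (circuitMem (ks ++ (equivPairs L).flatMap fun p => [p.1, p.2])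
        (es ++ Gadget.joinEdges n ((equivPairs L).map fun p => Gadget.eqGadget p.1 p.2))
        (n + 2 * (equivPairs L).length) (t + 2 * (equivPairs L).length))
      (L.length * (L.length * (350 * (N + 1) ^ 2) + 2) + 2) := by
  induction L using equivPairs.induct generalizing ks es n t with
  | case1 =>
    refine (Run.loop_nil rfl).congr ?_ (by simp)
    simp only [equivPairs, Gadget.joinEdges, List.flatMap_nil, List.map_nil, List.append_nil,
      List.length_nil, mul_zero, add_zero]
    rfl
  | case2 x r L ih =>
    have hL' := fun e he => hL e (List.mem_cons_of_mem _ he)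
    obtain ⟨hx, hr⟩ := hL _ List.mem_cons_self
    have hlen := length_occurrencesOf_add x L
    rw [List.length_cons] at hn
    have h1 := run_round ks es n t x r N L hr hx hL' (by omega)
    have h2 := ih (ks ++ (chain r (occurrencesOf x L)).flatMap fun p => [p.1, p.2])
      (es ++ Gadget.joinEdges n ((chain r (occurrencesOf x L)).map fun p =>
        Gadget.eqGadget p.1 p.2))
      (n + 2 * (occurrencesOf x L).length) (t + 2 * (occurrencesOf x L).length)
      (fun e he => hL' e (List.mem_of_mem_filter (List.mem_reverse.1 he))) (by omega)
    refine (Run.loop_push (k := .entries) ?_ h1 h2).congr ?_ ?_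
    · obtain ⟨a, l, h⟩ := exists_entryCode_append (x, r) (L.flatMap entryCode)
      exact ⟨a, l, h⟩
    · have hsize : (((chain r (occurrencesOf x L)).map fun p => Gadget.eqGadget p.1 p.2).map
          Gadget.size).sum = 2 * (occurrencesOf x L).length := by
        have : (Gadget.size ∘ fun p : ℕ × ℕ => Gadget.eqGadget p.1 p.2) = fun _ => 2 := rfl
        rw [List.map_map, this, List.map_const', List.sum_replicate, length_chain, smul_eq_mul,
          mul_comm]
      rw [equivPairs, List.flatMap_append, List.map_append, Gadget.joinEdges_append, hsize,
        List.length_append, length_chain]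
      simp only [mul_add, add_assoc, List.append_assoc]
    · rw [List.length_cons]
      have h3 := length_otherEntries_le x L
      generalize (otherEntries x L).length = k at *
      have h4 : k * (k * (350 * (N + 1) ^ 2) + 2) ≤
          L.length * ((L.length + 1) * (350 * (N + 1) ^ 2) + 2) := by gcongr; omega
      linarith

end Prog

/-! ### The machine for the transformation -/

namespace Prog

/-- Writes the instance whose parts are on the stacks. -/
def writeInstance : Prog :=
  seq (emit .target .edges) (seq (move .edges .output) (seq (move .keys .output)
    (seq (emit .size .keys) (seq (move .keys .output) (seq (clear .size) (clear .target))))))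

theorem run_writeInstance (ks es : List ℕ) (n t N S : ℕ) (hn : n ≤ N) (ht : t ≤ N)
    (hks : (encodeNats ks).length ≤ S) (hes : (encodeNats es).length ≤ S) :
    Run writeInstance (circuitMem ks es n t)
      { output := encodeNats (n :: (ks ++ (es ++ [t]))) } (30 * (N + 1) ^ 2 + 4 * S) := by
  refine ((run_emit rfl rfl (by decide) t _ rfl rfl rfl rfl).seq ((run_move (by decide) _).seq
    ((run_move (by decide) _).seq ((run_emit rfl rfl (by decide) n _ rfl rfl rfl rfl).seq
    ((run_move (by decide) _).seq ((run_clear _ _).seq (run_clear _ _))))))).congr ?_ ?_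
  · simp [Mem.get, Mem.set, circuitMem, encodeNats]
  · have h1 : (n + 1) ^ 2 ≤ (N + 1) ^ 2 := Nat.pow_le_pow_left (by omega) 2
    have h2 : (t + 1) ^ 2 ≤ (N + 1) ^ 2 := Nat.pow_le_pow_left (by omega) 2
    have h3 := length_bits_le n
    have h4 := length_bits_le t
    simp only [Mem.get, Mem.set, circuitMem, encodeBinary, List.length_append, List.length_reverse,
      List.length_map, List.length_singleton, List.length_replicate, List.length_nil]
    nlinarith

/-- The program for the transformation. The formula without clauses is treated separately. -/
def transform : Prog :=
  case .input fun
    | none => pushList .output (encodeNats [1, 0, 0, 0, 0, 0, 1]).reverse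
    | some a => seq (push .input a) (seq (seq readClauses rounds) writeInstance)

end Prog

theorem sum_map_le_mul_length {ι : Type} (l : List ι) (f : ι → ℕ) (c : ℕ) (h : ∀ x ∈ l, f x ≤ c) :
    (l.map f).sum ≤ c * l.length := by
  have := List.sum_le_card_nsmul (l.map f) c (by simpa using h)
  rwa [List.length_map, smul_eq_mul, mul_comm] at this

theorem ThreeCNF.length_clauses_le (l : List (List Literal)) :
    l.length + l.flatten.length ≤ (l.map encodeClause).flatten.length := by
  have h : ∀ C : List Literal, C.length ≤ (C.map encodeLiteral).flatten.length := by
    intro C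
    induction C with
    | nil => simp
    | cons x C ih =>
      rw [List.map_cons, List.flatten_cons, List.length_append, List.length_cons, encodeLiteral,
        List.length_cons]
      omega
  induction l with
  | nil => simp
  | cons C l ih =>
    have := h C
    simp only [List.length_cons, List.flatten_cons, List.length_append, List.map_cons, encodeClause,
      List.length_nil]
    omega

theorem ThreeCNF.length_bits_var_le (l : List (List Literal)) {C : List Literal} (hC : C ∈ l)
    {x : Literal} (hx : x ∈ C) : x.var.bits.length ≤ (l.map encodeClause).flatten.length := by
  have h1 := (List.sublist_flatten_of_mem (List.mem_map_of_mem (f := encodeClause) hC)).length_le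
  have h2 := (List.sublist_flatten_of_mem (List.mem_map_of_mem (f := encodeLiteral) hx)).length_le
  simp only [encodeClause, encodeLiteral, encodeBinary, List.length_cons, List.length_append,
    List.length_map, List.length_nil] at *
  omega

/-- A bound for the time that is spent on reading the clauses and identifying the occurrences. -/
noncomputable def readTime : Polynomial ℕ :=
  Polynomial.X * (800 * (8 * Polynomial.X + 10) ^ 2) + 2 +
    (Polynomial.X * (Polynomial.X * (350 * (8 * Polynomial.X + 10) ^ 2) + 2) + 2)

theorem Prog.run_transform (Φ : ThreeCNF) :
    Run transform { input := ThreeCNF.encode Φ } { output := Φ.toRouting.1.encode }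
      ((30 * (8 * Polynomial.X + 10) ^ 2 + 5 * readTime + 20 : Polynomial ℕ).eval
        (ThreeCNF.encode Φ).length) := by
  obtain ⟨l, hl⟩ := Φ
  by_cases h : l = []
  · subst h
    have h2 : (ThreeCNF.toRouting ⟨[], hl⟩).1 = loopInstance := by
      rw [ThreeCNF.toRouting, dif_pos rfl]
    rw [h2, encode_loopInstance]
    refine (Run.case (run_pushList _ _ _)).congr ?_ ?_
    · simp [Mem.set, Mem.get, ThreeCNF.encode]
    · have : (encodeNats [1, 0, 0, 0, 0, 0, 1]).length = 9 := by
        simp [encodeNats, encodeBinary]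
      rw [List.length_reverse, this, Polynomial.eval_add, Polynomial.eval_ofNat]
      omega
  · have h2 : (ThreeCNF.toRouting ⟨l, hl⟩).1 = (Gadget.formulaGadget l).toInstance
        (Gadget.formulaTarget l) (ThreeCNF.formulaTarget_pos h) := by
      rw [ThreeCNF.toRouting, dif_neg h]
    rw [h2, Gadget.encode_toInstance _ (Gadget.standard_formulaGadget l hl)]
    obtain ⟨s, hs⟩ : ∃ s, s = (l.map ThreeCNF.encodeClause).flatten.length := ⟨_, rfl⟩
    have hlen := ThreeCNF.length_clauses_le l
    have hvar := fun C (hC : C ∈ l) x (hx : x ∈ C) => ThreeCNF.length_bits_var_le l hC hx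
    rw [← hs] at hlen hvar
    have hsize := sum_map_le_mul_length l (fun C => Gadget.clauseSize C.length) 6
      fun C _ => Gadget.clauseSize_le _
    have hweight := sum_map_le_mul_length l (fun C => Gadget.clauseWeight C.length) 4
      fun C _ => Gadget.clauseWeight_le _
    have hfst := Gadget.map_fst_clauseEntries 0 l
    have hentries : (Gadget.clauseEntries 0 l).reverse.length = l.flatten.length := by
      rw [List.length_reverse, ← List.length_map (f := Prod.fst), hfst, List.length_map]
    have hpairs := length_equivPairs_le (Gadget.clauseEntries 0 l).reverse
    -- There are at most `6 s` vertices in the circuits of the clauses and at most `2 s` in the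
    -- other ones; `readClauses` asks for a margin of `9`.
    have hbound : ∀ e ∈ (Gadget.clauseEntries 0 l).reverse,
        e.1.bits.length ≤ 8 * s + 9 ∧ e.2 ≤ 8 * s + 9 := by
      intro e he
      rw [List.mem_reverse] at he
      have h1 := Gadget.snd_lt_of_mem_clauseEntries 0 l hl he
      have h2 := List.mem_map_of_mem (f := Prod.fst) he
      rw [hfst] at h2
      obtain ⟨x, hx, h2⟩ := List.mem_map.1 h2
      obtain ⟨C, hC, hx⟩ := List.mem_flatten.1 hx
      have := hvar C hC x hx
      rw [← h2]
      omega
    have hn : (Gadget.formulaGadget l).size =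
        (l.map fun C => Gadget.clauseSize C.length).sum +
          2 * (Gadget.formulaPairs l).length := by
      have : (Gadget.size ∘ fun p : ℕ × ℕ => Gadget.eqGadget p.1 p.2) = fun _ => 2 := rfl
      rw [Gadget.formulaGadget, Gadget.size_join, Gadget.formulaGadgets, List.map_append,
        List.sum_append, Gadget.size_clauseGadgets, List.map_map, this, List.map_const',
        List.sum_replicate, smul_eq_mul, mul_comm 2]
    have r1 := run_readClauses l hl [] [] 0 0 (8 * s + 9) (by omega)
      (fun C hC x hx => (hvar C hC x hx).trans (by omega)) []
    rw [List.append_nil] at r1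
    have r2 := r1.seq (run_rounds _ _ _ _ (8 * s + 9) _ hbound (by omega))
    have r3 : Run (seq readClauses rounds) { input := (l.map ThreeCNF.encodeClause).flatten }
        (circuitMem (Gadget.formulaGadget l).keys ((Gadget.formulaGadget l).edges 0)
          (Gadget.formulaGadget l).size (Gadget.formulaTarget l)) (readTime.eval s) := by
      refine r2.congr ?_ ?_
      · rw [hn, Gadget.keys_formulaGadget, Gadget.formulaGadget, Gadget.edges_join,
          Gadget.formulaGadgets, Gadget.joinEdges_append, Gadget.size_clauseGadgets]
        simp only [Gadget.formulaPairs, Gadget.formulaTarget, List.nil_append, zero_add]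
      · simp only [readTime, Polynomial.eval_add, Polynomial.eval_mul, Polynomial.eval_pow,
          Polynomial.eval_X, Polynomial.eval_ofNat, hentries]
        have h1 : l.flatten.length ≤ s := by omega
        have h2 : l.length ≤ s := by omega
        have h3 : 8 * s + 10 = 8 * s + 9 + 1 := rfl
        rw [h3]
        gcongr
    have hkeys := r3.length_le .keys
    have hedges := r3.length_le .edges
    simp only [Mem.get, circuitMem, List.length_reverse, List.length_nil, zero_add] at hkeys hedges
    have htarget : Gadget.formulaTarget l ≤ 8 * s + 9 := by
      rw [Gadget.formulaTarget, Gadget.formulaPairs]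
      omega
    rw [Gadget.formulaPairs] at hn
    have r4 := r3.seq (run_writeInstance _ _ _ _ (8 * s + 9) (readTime.eval s) (by omega) htarget
      hkeys hedges)
    obtain ⟨a, inp, ha⟩ : ∃ a inp, (l.map ThreeCNF.encodeClause).flatten = a :: inp := by
      obtain ⟨C, l, rfl⟩ := List.exists_cons_of_ne_nil h
      exact ⟨_, _, rfl⟩
    rw [ThreeCNF.encode, ← hs]
    rw [ha] at r4 ⊢
    refine (Run.case (k := .input) ((Run.push .input a _).seq r4)).congr rfl ?_
    simp only [Polynomial.eval_add, Polynomial.eval_mul, Polynomial.eval_pow, Polynomial.eval_X,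
      Polynomial.eval_ofNat]
    have h3 : 8 * s + 10 = 8 * s + 9 + 1 := rfl
    rw [h3]
    omega

theorem ThreeCNF.computable_toRouting :
    Nonempty (Turing.TM2ComputableInPolyTime ThreeCNF.encode (maximalRouting 6 2).encode
      ThreeCNF.toRouting) :=
  Prog.computableInPolyTime_of_run _ _ Prog.run_transform

theorem theorem6 :
    ∃ f : ThreeCNF → {I : RoutingInstance // I.circuit.WidthLE 6 ∧ I.circuit.ValencyLE 2},
      IsParsimoniousTransformation threeSAT (maximalRouting 6 2) f ∧
      ∀ Φ : ThreeCNF, Φ.clauses ≠ [] → (∀ C ∈ Φ.clauses, C ≠ []) →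
        (f Φ).1.target = Φ.cycleThreshold ∧
        (∀ ρ : (f Φ).1.RespectingRouting, (f Φ).1.circuit.numCycles ρ.1 ≤ Φ.cycleThreshold) ∧
        ∃ routingOf : Φ.Assignment → (f Φ).1.RespectingRouting,
          Function.Injective routingOf ∧
          ∀ ρ : (f Φ).1.RespectingRouting,
            (f Φ).1.circuit.numCycles ρ.1 = Φ.cycleThreshold ↔
              ∃ α : Φ.Assignment, Φ.Satisfies α ∧ routingOf α = ρ := by
  refine ⟨ThreeCNF.toRouting, ⟨ThreeCNF.computable_toRouting, ThreeCNF.card_solution_toRouting⟩,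
    fun Φ h h' => ?_⟩
  have h2 : Φ.toRouting = _ := dif_neg h
  rw [h2, ← Φ.formulaTarget_eq h']
  exact ⟨rfl, fun ρ => Φ.numCycles_le _ ρ.2, Φ.routingOf, Φ.routingOf_injective,
    Φ.numCycles_eq_iff⟩
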